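/- **Setting.** Fix an integer bucket size $b\ge 1$. A hash table on an index set $\mathfrak T$, where $\mathfrak T=\mathbb Z_m$ ($m\ge1$ buckets, arranged cyclically) or $\mathfrak T=\mathbb Z$, is given by the numbers $X_i\ge 0$ of keys with hash address $i\in\mathfrak T$; for $\mathfrak T=\mathbb Z_m$ all sequences are regarded as $m$-periodic sequences on $\mathbb Z$. Assume $\sum_{i=0}^{N-1}(b-X_{-i})\to\infty$ as $N\to\infty$ (for $\mathbb Z_m$ this means that there are fewer than $bm$ keys). The overflow $Q_i$ and the profile $(H_i)_i$ of the table are $$Q_i=\max_{j\le i}\sum_{k=j+1}^{i}(X_k-b),\qquad H_i=X_i+Q_{i-1}\qquad(i,j\in\mathbb Z);$$ this is the unique solution of $H_i=X_i+Q_{i-1}$, $Q_i=\max(H_i-b,0)$ such that for every $i$ there is $i_0<i$ with $Q_{i_0}=0$. The same formulas are used for a cyclic table with exactly $bm$ keys. *Exact model:* $n$ keys with independent uniformly distributed hash addresses in $\mathbb Z_m$ (all $m^n$ assignments equally likely). *Doubly infinite Poisson model with parameter $\alpha$:* $\mathfrak T=\mathbb Z$ and $(X_i)_{i\in\mathbb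 Z}$ i.i.d. with $X_i\sim\mathrm{Po}(b\alpha)$; its profile, almost surely well defined when $\alpha<1$, is denoted $(H_{\alpha;i})_{i\in\mathbb Z}$. **Theorem.** Let $P$ be a (possibly random) non-negative integer-valued property of a hash table whose distribution is determined by the profile $(H_i)_{i\in\mathfrak T}$. Let $0\le\alpha<1$, and suppose that almost surely $(H_{\alpha;i})_i$ is such that there is an $N$ for which the distribution of $P$ is the same for every hash table (on any $\mathbb Z_m$, or on $\mathbb Z$) whose profile equals $H_{\alpha;i}$ for $|i|\le N$. Let $P_{m,n}$ and $P_\alpha$ be the random variables given by $P$ in the exact model with $m$ buckets and $n$ keys and in the doubly infinite Poisson model, with probability generating functions $p_{m,n}(q)=\mathbb E\,q^{P_{m,n}}$ and $p_\alpha(q)=\mathbb E\,q^{P_\alpha}$; when the keys do not fit ($n>bm$, or $m=0$), let the law of $P_{m,n}$ be any fixed probability law on $\{0,1,2,\dots\}$, chosen arbitrarily for each such $(m,n)$. Then $P_\alpha$ has a well-defined law, and: 1. If $m,n\to\infty$ with $n/(bm)\to\alpha$, then $P_{m,n}\to P_\alpha$ in distribution, and $p_{m,n}(q)\to p_\alpha(q)$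 for every complex $q$ with $|q|\le1$. 2. If $|q|\le 1$, then the Poisson transform satisfies, as $m\to\infty$, $$\mathbf P_m[p_{m,n}(q);b\alpha]:=e^{-bm\alpha}\sum_{n\ge0}\frac{(bm\alpha)^n}{n!}\,p_{m,n}(q)\;\longrightarrow\;p_\alpha(q).$$ 3. Let $|q|\le1$ and $P(z,w,q):=\sum_{m\ge0}w^{bm}\sum_{n\ge0}p_{m,n}(q)\frac{(mz)^n}{n!}$. Suppose that $y\mapsto P(b\alpha,y^{1/b}e^{-\alpha},q)$, which does not depend on the choice of $y^{1/b}$ and is defined for $|y|<1$, extends to a function on a disc $|y|<r$ with $r>1$ that is analytic except for a simple pole at $y=1$. Then its residue at $y=1$ equals $-p_\alpha(q)$. -/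

import Mathlib

open Filter Topology MeasureTheory ProbabilityTheory
open scoped NNReal

/-! ### Hash tables, overflow and profile

A hash table with buckets of size `b` is described by the numbers `X i` of keys with hash address
`i`. A table on the cyclic group `ℤ/m` is described by its `m`-periodic extension to `ℤ`; a doubly
infinite table has index set `ℤ` itself. The number of buckets is recorded as an element of `ℕ∞`,
with `⊤` for the doubly infinite table. -/

/-- `∑_{k=i-L+1}^{i} (X_k - b)`. -/
def excess (b : ℕ) (X : ℤ → ℕ) (i : ℤ) (L : ℕ) : ℤ :=
  ∑ k ∈ Finset.range L, ((X (i - k) : ℤ) - b)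

/-- The overflow `Q_i = max_{j ≤ i} ∑_{k=j+1}^{i} (X_k - b)` from bucket `i`
(the term `j = i` is `0`, and `j = i - L`). -/
noncomputable def overflow (b : ℕ) (X : ℤ → ℕ) (i : ℤ) : ℕ :=
  (⨆ L : ℕ, excess b X i L).toNat

/-- The profile: `H_i = X_i + Q_{i-1}` is the number of keys that try bucket `i`. -/
noncomputable def profile (b : ℕ) (X : ℤ → ℕ) (i : ℤ) : ℕ :=
  X i + overflow b X (i - 1)

/-- `∑_{i=0}^{N-1} (b - X_{-i}) → ∞` as `N → ∞`: the condition under which hashing on `ℤ` is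
defined. For an `m`-periodic `X` it says that there are fewer than `b * m` keys per period. -/
def LoadCondition (b : ℕ) (X : ℤ → ℕ) : Prop :=
  Tendsto (fun N : ℕ => ∑ i ∈ Finset.range N, ((b : ℤ) - X (-(i : ℤ)))) atTop atTop

/-- `X` gives the numbers of keys per hash address of a hash table with `m` buckets of size `b`:
`m = ⊤` is the doubly infinite table on `ℤ`, a finite `m ≥ 1` is the cyclic table on `ℤ/m`. -/
structure IsHashTable (b : ℕ) (m : ℕ∞) (X : ℤ → ℕ) : Prop where
  ne_zero : m ≠ 0
  periodic : ∀ k : ℕ, m = k → Function.Periodic X k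
  load : LoadCondition b X

/-- The equations of linear probing, `H_i = X_i + Q_{i-1}` and `Q_i = (H_i - b)_+`, where for
every `i` there is some `i₀ < i` with `Q_{i₀} = 0`. -/
def IsProfile (b : ℕ) (X H : ℤ → ℕ) : Prop :=
  ∃ Q : ℤ → ℕ, (∀ i, H i = X i + Q (i - 1)) ∧ (∀ i, Q i = H i - b) ∧
    ∀ i, ∃ i₀ < i, Q i₀ = 0

theorem excess_succ (b : ℕ) (X : ℤ → ℕ) (i : ℤ) (L : ℕ) :
    excess b X i (L + 1) = ((X i : ℤ) - b) + excess b X (i - 1) L := by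
  unfold excess
  rw [Finset.sum_range_succ', add_comm]
  congr 1
  · simp
  · refine Finset.sum_congr rfl fun k _ => ?_
    rw [show i - ((k + 1 : ℕ) : ℤ) = i - 1 - k by push_cast; ring]

theorem excess_add (b : ℕ) (X : ℤ → ℕ) (M : ℕ) : ∀ (i : ℤ) (L : ℕ),
    excess b X i (M + L) = excess b X i M + excess b X (i - M) L := by
  induction M with
  | zero => intro i L; simp [excess]
  | succ M ih =>
    intro i L
    rw [show M + 1 + L = (M + L) + 1 by ring, excess_succ, ih, excess_succ,
      show i - ((M + 1 : ℕ) : ℤ) = i - 1 - M by push_cast; ring]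
    ring

theorem tendsto_excess {b : ℕ} {X : ℤ → ℕ} (h : LoadCondition b X) (i : ℤ) :
    Tendsto (excess b X i) atTop atBot := by
  have h0 : Tendsto (excess b X 0) atTop atBot := by
    have := tendsto_neg_atTop_atBot.comp h
    refine this.congr fun N => ?_
    simp [excess, Finset.sum_sub_distrib]
  obtain ⟨n, rfl | rfl⟩ := i.eq_nat_or_neg
  · have key : ∀ L, excess b X n (L + n) = excess b X n n + excess b X 0 L := by
      intro L
      rw [add_comm L n, excess_add]; simp
    rw [← tendsto_add_atTop_iff_nat n]
    simp_rw [key]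
    exact tendsto_atBot_add_const_left _ _ h0
  · have key : ∀ L, excess b X (-n) L = -excess b X 0 n + excess b X 0 (L + n) := by
      intro L
      rw [add_comm L n, excess_add]; simp
    refine (tendsto_congr key).mpr ?_
    exact tendsto_atBot_add_const_left _ _ ((tendsto_add_atTop_iff_nat n).mpr h0)

theorem bddAbove_excess {b : ℕ} {X : ℤ → ℕ} (h : LoadCondition b X) (i : ℤ) :
    BddAbove (Set.range (excess b X i)) :=
  ((tendsto_excess h i).eventually_le_atBot 0).exists_forall_of_atTop.elim fun n hn => by
    refine ((Set.finite_Iio n).image (excess b X i)).bddAbove.union (bddAbove_Iic (a := 0)) |>.mono ?_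
    rintro _ ⟨L, rfl⟩
    rcases lt_or_ge L n with hL | hL
    · exact Or.inl ⟨L, hL, rfl⟩
    · exact Or.inr (hn L hL)

theorem overflow_eq_of_isGreatest {b : ℕ} {X : ℤ → ℕ} {i : ℤ} {q : ℕ}
    (h : IsGreatest (Set.range (excess b X i)) q) : overflow b X i = q := by
  unfold overflow iSup
  rw [h.csSup_eq]; simp

theorem isGreatest_overflow {b : ℕ} {X : ℤ → ℕ} (h : LoadCondition b X) (i : ℤ) :
    IsGreatest (Set.range (excess b X i)) (overflow b X i) := by
  have hb := bddAbove_excess h i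
  have hne : (Set.range (excess b X i)).Nonempty := Set.range_nonempty _
  have h0 : (0 : ℤ) ≤ sSup (Set.range (excess b X i)) :=
    le_csSup hb ⟨0, by simp [excess]⟩
  have : ((overflow b X i : ℕ) : ℤ) = sSup (Set.range (excess b X i)) := Int.toNat_of_nonneg h0
  rw [this]
  exact ⟨Int.csSup_mem hne hb, fun _ hx => le_csSup hb hx⟩

/-- `profile` is the unique solution of the equations of linear probing. -/
theorem isProfile_iff {b : ℕ} {X : ℤ → ℕ} (h : LoadCondition b X) (H : ℤ → ℕ) :
    IsProfile b X H ↔ H = profile b X := by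
  constructor
  · rintro ⟨Q, hH, hQ, hz⟩
    have lower : ∀ (L : ℕ) (i : ℤ), excess b X i L ≤ Q i := by
      intro L
      induction L with
      | zero => intro i; simp [excess]
      | succ L ih =>
        intro i
        rw [excess_succ]
        have h1 := ih (i - 1); have h2 := hQ i; have h3 := hH i
        omega
    have upper : ∀ (L : ℕ) (i : ℤ), Q (i - L) = 0 → ∃ L', excess b X i L' = Q i := by
      intro L
      induction L with
      | zero => intro i hi; exact ⟨0, by simp at hi; simp [excess, hi]⟩
      | succ L ih =>
        intro i hi
        by_cases hq : Q i = 0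
        · exact ⟨0, by simp [excess, hq]⟩
        · obtain ⟨L', hL'⟩ := ih (i - 1) (by
            rw [show i - 1 - (L : ℤ) = i - ((L + 1 : ℕ) : ℤ) by push_cast; ring]; exact hi)
          refine ⟨L' + 1, ?_⟩
          rw [excess_succ, hL']
          have h2 := hQ i; have h3 := hH i
          omega
    funext i
    rw [hH i, profile]
    congr 1
    refine (overflow_eq_of_isGreatest ⟨?_, ?_⟩).symm
    · obtain ⟨i₀, hlt, hi₀⟩ := hz (i - 1)
      exact upper (i - 1 - i₀).toNat (i - 1) (by
        rw [show i - 1 - ((i - 1 - i₀).toNat : ℤ) = i₀ by omega]; exact hi₀)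
    · rintro _ ⟨L, rfl⟩; exact lower L _
  · rintro rfl
    refine ⟨overflow b X, fun i => rfl, fun i => ?_, fun i => ?_⟩
    · refine overflow_eq_of_isGreatest ⟨?_, ?_⟩
      · obtain ⟨L, hL⟩ := (isGreatest_overflow h (i - 1)).1
        by_cases hb : profile b X i ≤ b
        · exact ⟨0, by simp [excess, Nat.sub_eq_zero_of_le hb]⟩
        · refine ⟨L + 1, ?_⟩
          rw [excess_succ, hL]
          unfold profile at hb ⊢
          omega
      · rintro _ ⟨L, rfl⟩
        cases L with
        | zero => simp [excess]
        | succ L =>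
          have := (isGreatest_overflow h (i - 1)).2 ⟨L, rfl⟩
          rw [excess_succ]
          unfold profile
          omega
    · have hb : BddAbove (Set.range fun M : ℕ => excess b X i (M + 1)) :=
        (bddAbove_excess h i).mono (by rintro _ ⟨M, rfl⟩; exact ⟨M + 1, rfl⟩)
      obtain ⟨M, hM⟩ := Int.csSup_mem (Set.range_nonempty _) hb
      refine ⟨i - (M + 1 : ℕ), by push_cast; omega, ?_⟩
      refine overflow_eq_of_isGreatest ⟨⟨0, by simp [excess]⟩, ?_⟩
      rintro _ ⟨L, rfl⟩
      have h1 : excess b X i (M + L + 1) ≤ _ := le_csSup hb ⟨M + L, rfl⟩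
      rw [← hM, show M + L + 1 = M + 1 + L by ring, excess_add] at h1
      simpa using h1

/-! ### The exact model and the doubly infinite Poisson model

A (possibly random) property determined by the profile is a map `P` that assigns to the number of
buckets `m : ℕ∞` and a profile the distribution of the property for the tables with this profile. -/

/-- `X_i` for the table in which key `k` has hash address `a k`, with indices taken modulo `m`. -/
def addressCount {m n : ℕ} (a : Fin n → ZMod m) (i : ℤ) : ℕ :=
  (Finset.univ.filter fun k => a k = (i : ZMod m)).card

/-- The law of `P_{m,n}`: the `m ^ n` assignments of hash addresses to `n` keys are equally
likely. If the `n` keys do not fit (`n > b * m`, or `m = 0`), the law is given by an arbitrary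
convention `R m n`. -/
noncomputable def exactPMF (b : ℕ) (P : ℕ∞ → (ℤ → ℕ) → PMF ℕ) (R : ℕ → ℕ → PMF ℕ)
    (m n : ℕ) : PMF ℕ :=
  if h : 0 < m ∧ n ≤ b * m then
    haveI : NeZero m := ⟨h.1.ne'⟩
    (PMF.uniformOfFintype (Fin n → ZMod m)).bind fun a => P m (profile b (addressCount a))
  else R m n

/-- The law of `P_{m,n}` as a probability measure on `ℕ`. -/
noncomputable def exactLaw (b : ℕ) (P : ℕ∞ → (ℤ → ℕ) → PMF ℕ) (R : ℕ → ℕ → PMF ℕ)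
    (m n : ℕ) : ProbabilityMeasure ℕ :=
  ⟨(exactPMF b P R m n).toMeasure, inferInstance⟩

/-- The law of `(X_i)_{i ∈ ℤ}`, independent with `X_i ∼ Po(b α)`. -/
noncomputable def poissonField (b : ℕ) (α : ℝ≥0) : Measure (ℤ → ℕ) :=
  Measure.infinitePi fun _ : ℤ => poissonMeasure (b * α)

/-- The law of `P_α`, the property for the doubly infinite Poisson model. -/
noncomputable def poissonLaw (b : ℕ) (α : ℝ≥0) (P : ℕ∞ → (ℤ → ℕ) → PMF ℕ) : Measure ℕ :=
  (poissonField b α).bind fun X => (P ⊤ (profile b X)).toMeasure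

/-- Almost surely there is some `N` such that `P` has the same distribution for every hash table
whose profile equals `H_{α;i}` for `|i| ≤ N`. -/
def IsLocallyDetermined (b : ℕ) (α : ℝ≥0) (P : ℕ∞ → (ℤ → ℕ) → PMF ℕ) : Prop :=
  ∀ᵐ X ∂(poissonField b α), ∃ N : ℕ, ∀ (m : ℕ∞) (X' : ℤ → ℕ), IsHashTable b m X' →
    (∀ i : ℤ, |i| ≤ N → profile b X' i = profile b X i) →
    P m (profile b X') = P ⊤ (profile b X)

/-! ### Generating functions -/

/-- The probability generating function `E q^P` of a law on `ℕ`. -/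
noncomputable def pgf (μ : Measure ℕ) (q : ℂ) : ℂ := ∫ k, q ^ k ∂μ

/-- The Poisson transform `e^{-bmα} ∑_n (bmα)^n / n! f_n`. -/
noncomputable def poissonTransform (b : ℕ) (α : ℝ≥0) (m : ℕ) (f : ℕ → ℂ) : ℂ :=
  Complex.exp (-(b * m * (α : ℝ))) *
    ∑' n : ℕ, ((b * m * (α : ℝ) : ℂ) ^ n / n.factorial) * f n

/-- The generating function `∑_m w^{bm} ∑_n p_{m,n} (m z)^n / n!`. -/
noncomputable def trivariateGF (b : ℕ) (p : ℕ → ℕ → ℂ) (z w : ℂ) : ℂ :=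
  ∑' m : ℕ, w ^ (b * m) * ∑' n : ℕ, p m n * ((m * z) ^ n / n.factorial)

/-- `g` has a simple pole at `z₀`, with residue `ρ`. -/
def HasSimplePoleWithResidue (g : ℂ → ℂ) (z₀ ρ : ℂ) : Prop :=
  ρ ≠ 0 ∧ ∃ h : ℂ → ℂ, AnalyticAt ℂ h z₀ ∧ ∀ᶠ y in 𝓝[≠] z₀, g y = ρ / (y - z₀) + h y

/-! ### Overflow of cut-off and of periodic tables -/

/-! On discrete `ℕ`, weak convergence follows from `poissonLaw A ≤ liminf exactLaw A` for every set
`A` (portmanteau), so only lower bounds are needed. `localInf`, the least probability of `A` among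
all tables with a given profile on `[-N, N]`, never exceeds the true probability, depends on
finitely many values, and by local determinacy is almost surely equal to the true probability for
large `N`.

The profile on `[-N, N]` is read from addresses in `[-K, K]` unless a stretch of at least `K - N`
buckets is overloaded. In the Poisson model the strong law excludes this for large `K`. In the exact
model a Chernoff bound (`card_excess_pos_le`) gives it probability at most a constant times `c ^ (K
- N)` for fixed `N`, with `c < 1`, uniformly in `m` and `n` at load at most `β < 1`. Counts in a
fixed window converge to independent Poisson variables by an exact count.
`poissonLaw_le_liminf_exactLaw` combines these with Fatou's lemma, once for each of the limits in
the model size, `K` and `N`.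

The Poisson transform averages over a Poisson number of keys with mean and variance `bmα`, so
Chebyshev's inequality reduces it to the limit already proved. At `z = bα`, `w = y^{1/b}e^{-α}` the
coefficient of `y^m` in the generating function is this transform, and Abel summation of a
convergent sequence gives the residue. -/

/-- Mutual cofinality decides equality of suprema without boundedness, so no load condition is
needed. -/
theorem overflow_eq_of_forall_exists_le {b : ℕ} {X Y : ℤ → ℕ} {i j : ℤ}
    (h₁ : ∀ L, ∃ L', excess b X i L ≤ excess b Y j L')
    (h₂ : ∀ L, ∃ L', excess b Y j L ≤ excess b X i L') : overflow b X i = overflow b Y j := by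
  unfold overflow iSup
  congr 1
  refine csSup_eq_csSup_of_forall_exists_le ?_ ?_
  · rintro _ ⟨L, rfl⟩
    exact (h₁ L).elim fun L' h => ⟨_, ⟨L', rfl⟩, h⟩
  · rintro _ ⟨L, rfl⟩
    exact (h₂ L).elim fun L' h => ⟨_, ⟨L', rfl⟩, h⟩

theorem excess_congr {b : ℕ} {X Y : ℤ → ℕ} {i : ℤ} {L : ℕ}
    (h : ∀ j, i - L < j → j ≤ i → X j = Y j) : excess b X i L = excess b Y i L := by
  refine Finset.sum_congr rfl fun k hk => ?_
  have := Finset.mem_range.mp hk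
  rw [h (i - k) (by omega) (by omega)]

theorem excess_le_zero_of_forall_eq_zero {b : ℕ} {X : ℤ → ℕ} {i : ℤ} (h : ∀ j ≤ i, X j = 0)
    (L : ℕ) : excess b X i L ≤ 0 := by
  refine Finset.sum_nonpos fun k _ => ?_
  rw [h (i - k) (by omega)]
  simp

/-- The extension by `0` of a table on `[-K, K]`. -/
noncomputable def extendZero {K : ℕ} (x : Finset.Icc (-(K : ℤ)) K → ℕ) (i : ℤ) : ℕ :=
  if h : i ∈ Finset.Icc (-(K : ℤ)) K then x ⟨i, h⟩ else 0

/-- The table with all keys outside `[-K, K]` removed. -/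
noncomputable def cutoff (K : ℕ) (X : ℤ → ℕ) : ℤ → ℕ :=
  extendZero ((Finset.Icc (-(K : ℤ)) K).restrict X)

theorem cutoff_of_abs_le {K : ℕ} (X : ℤ → ℕ) {i : ℤ} (h : |i| ≤ K) : cutoff K X i = X i := by
  have : i ∈ Finset.Icc (-(K : ℤ)) K := Finset.mem_Icc.mpr (abs_le.mp h)
  simp only [cutoff, extendZero, this, dif_pos, Finset.restrict]

theorem extendZero_of_lt {K : ℕ} (x : Finset.Icc (-(K : ℤ)) K → ℕ) {i : ℤ} (h : i < -K) :
    extendZero x i = 0 := by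
  rw [extendZero, dif_neg]
  simp only [Finset.mem_Icc]
  omega

/-- Each empty bucket contributes `b ≥ 1`. This makes every cut-off a legitimate doubly infinite
table, hence a competitor in `localInf`. -/
theorem loadCondition_of_forall_lt_eq_zero {b : ℕ} (hb : 1 ≤ b) {X : ℤ → ℕ} {K : ℕ}
    (h : ∀ i : ℤ, i < -K → X i = 0) : LoadCondition b X := by
  unfold LoadCondition
  rw [← tendsto_add_atTop_iff_nat (K + 1)]
  refine tendsto_atTop_mono (f := fun N : ℕ =>
    ∑ i ∈ Finset.range (K + 1), ((b : ℤ) - X (-(i : ℤ))) + (N : ℤ)) (fun N => ?_) ?_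
  · rw [add_comm N, Finset.sum_range_add _ (K + 1) N]
    refine add_le_add le_rfl ?_
    rw [show (N : ℤ) = ∑ i ∈ Finset.range N, (1 : ℤ) by simp]
    refine Finset.sum_le_sum fun i _ => ?_
    rw [h _ (by push_cast; omega)]
    push_cast
    omega
  · exact tendsto_atTop_add_const_left _ _ tendsto_natCast_atTop_atTop

theorem isHashTable_top_extendZero {b : ℕ} (hb : 1 ≤ b) {K : ℕ}
    (x : Finset.Icc (-(K : ℤ)) K → ℕ) : IsHashTable b ⊤ (extendZero x) where
  ne_zero := by simp
  periodic k hk := by simp at hk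
  load := loadCondition_of_forall_lt_eq_zero hb fun _ hi => extendZero_of_lt x hi

/-- The stretch from `-K` to `i` has length `i + K + 1`. Past it the cut-off table only loses
excess, and in `X` the hypothesis makes longer stretches irrelevant to the maximum. -/
theorem overflow_cutoff {b : ℕ} {X : ℤ → ℕ} {K : ℕ} {i : ℤ} (hi : |i| ≤ K)
    (h : ∀ L : ℕ, i + K + 1 ≤ L → ∃ L' : ℕ, (L' : ℤ) ≤ i + K + 1 ∧
      excess b X i L ≤ excess b X i L') : overflow b (cutoff K X) i = overflow b X i := by
  have hi' := abs_le.mp hi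
  have agree : ∀ L : ℕ, (L : ℤ) ≤ i + K + 1 → excess b (cutoff K X) i L = excess b X i L := by
    intro L hL
    refine excess_congr fun j hj hj' => cutoff_of_abs_le X (abs_le.mpr ⟨by omega, by omega⟩)
  refine overflow_eq_of_forall_exists_le (fun L => ?_) (fun L => ?_)
  · rcases le_or_gt (L : ℤ) (i + K + 1) with hL | hL
    · exact ⟨L, (agree L hL).le⟩
    · obtain ⟨L₁, hL₁⟩ : ∃ L₁ : ℕ, (L₁ : ℤ) = i + K + 1 := ⟨(i + K + 1).toNat, by omega⟩
      obtain ⟨d, rfl⟩ : ∃ d, L = L₁ + d := ⟨L - L₁, by omega⟩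
      refine ⟨L₁, ?_⟩
      rw [excess_add, agree L₁ hL₁.le]
      have := excess_le_zero_of_forall_eq_zero (b := b) (X := cutoff K X) (i := i - L₁)
        (fun j hj => extendZero_of_lt _ (by omega)) d
      omega
  · rcases le_or_gt (L : ℤ) (i + K + 1) with hL | hL
    · exact ⟨L, (agree L hL).ge⟩
    · obtain ⟨L', hL', hle⟩ := h L hL.le
      exact ⟨L', hle.trans (agree L' hL').ge⟩

theorem profile_cutoff {b : ℕ} {X : ℤ → ℕ} {N K : ℕ} (hK : N < K)
    -- The range starts at `-N - 1` because `H_i` involves `Q_{i-1}`.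
    (h : ∀ i : ℤ, -N - 1 ≤ i → i ≤ N → ∀ L : ℕ, i + K + 1 ≤ L → ∃ L' : ℕ, (L' : ℤ) ≤ i + K + 1 ∧
      excess b X i L ≤ excess b X i L') {i : ℤ} (hi : |i| ≤ N) :
    profile b (cutoff K X) i = profile b X i := by
  have hi' := abs_le.mp hi
  rw [profile, profile, cutoff_of_abs_le X (hi.trans (by omega)),
    overflow_cutoff (abs_le.mpr ⟨by omega, by omega⟩) (h _ (by omega) (by omega))]

theorem eventually_profile_cutoff {b : ℕ} {X : ℤ → ℕ} (hX : LoadCondition b X) (N : ℕ) :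
    ∀ᶠ K : ℕ in atTop, ∀ i : ℤ, |i| ≤ N → profile b (cutoff K X) i = profile b X i := by
  have : ∀ i ∈ Finset.Icc (-N - 1 : ℤ) N, ∃ L₀ : ℕ, ∀ L ≥ L₀, excess b X i L ≤ 0 := fun i _ =>
    eventually_atTop.mp ((tendsto_excess hX i).eventually_le_atBot 0)
  choose! L₀ hL₀ using this
  filter_upwards [eventually_gt_atTop (N + (Finset.Icc (-N - 1 : ℤ) N).sup L₀)] with K hK
  refine fun i hi => profile_cutoff (by omega) (fun i h1 h2 L hL => ?_) hi
  have hmem := Finset.mem_Icc.mpr ⟨h1, h2⟩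
  have := Finset.le_sup (f := L₀) hmem
  exact ⟨0, by push_cast; omega, by simpa [excess] using hL₀ i hmem L (by omega)⟩

/-! ### Periodic tables -/

theorem excess_periodic {b m : ℕ} {X : ℤ → ℕ} (hX : Function.Periodic X m) (i : ℤ) (L : ℕ) :
    excess b X (i - m) L = excess b X i L := by
  refine Finset.sum_congr rfl fun k _ => ?_
  rw [show i - m - k = (i - k) - m by ring, hX.sub_eq]

/-- A whole period has nonpositive excess, so removing periods does not lower the excess and only
stretches shorter than `m` matter. -/
theorem exists_excess_le_of_periodic {b m L₀ : ℕ} {X : ℤ → ℕ} (hm : 0 < m)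
    (hX : Function.Periodic X m) {i : ℤ} (h : excess b X i m ≤ 0)
    (h' : ∀ L, L₀ ≤ L → L < m → excess b X i L ≤ 0) (L : ℕ) :
    ∃ L' ≤ L₀, excess b X i L ≤ excess b X i L' := by
  induction L using Nat.strong_induction_on with
  | _ L ih =>
    rcases lt_or_ge L m with hL | hL
    · rcases le_or_gt L₀ L with hL' | hL'
      · exact ⟨0, by omega, by simpa [excess] using h' L hL' hL⟩
      · exact ⟨L, hL'.le, le_rfl⟩
    · obtain ⟨d, rfl⟩ : ∃ d, L = m + d := ⟨L - m, by omega⟩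
      obtain ⟨L', h1, h2⟩ := ih d (by omega)
      refine ⟨L', h1, ?_⟩
      rw [excess_add, excess_periodic hX]
      omega

theorem loadCondition_of_periodic {b m : ℕ} {X : ℤ → ℕ} (hX : Function.Periodic X m)
    (h : excess b X 0 m < 0) : LoadCondition b X := by
  have hm : 0 < m := by
    rcases m.eq_zero_or_pos with rfl | hm
    · simp [excess] at h
    · exact hm
  -- Each period lowers the integer excess by at least one; `C` bounds the excess over the first
  -- period.
  obtain ⟨C, hC⟩ : ∃ C : ℤ, ∀ L, excess b X 0 L + (L / m : ℕ) ≤ C := by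
    obtain ⟨C, hC⟩ := ((Finset.range m).image (excess b X 0)).bddAbove
    refine ⟨C, fun L => ?_⟩
    induction L using Nat.strong_induction_on with
    | _ L ih =>
      rcases lt_or_ge L m with hL | hL
      · rw [Nat.div_eq_of_lt hL]
        simpa using hC (by simpa using ⟨L, hL, rfl⟩)
      · obtain ⟨d, rfl⟩ : ∃ d, L = m + d := ⟨L - m, by omega⟩
        have := ih d (by omega)
        rw [excess_add, excess_periodic hX, Nat.add_div_left _ hm]
        push_cast
        push_cast at this
        omega
  unfold LoadCondition
  have hd : Tendsto (fun L : ℕ => ((L / m : ℕ) : ℤ) + -C) atTop atTop :=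
    tendsto_atTop_add_const_right _ _
      (tendsto_natCast_atTop_atTop.comp (Nat.tendsto_div_const_atTop hm.ne'))
  refine tendsto_atTop_mono (fun L => ?_) hd
  have h1 := hC L
  have h2 : ∑ i ∈ Finset.range L, ((b : ℤ) - X (-(i : ℤ))) = -excess b X 0 L := by
    simp [excess, Finset.sum_sub_distrib]
  omega

/-! ### Counting assignments of hash addresses -/

theorem Fin.card_filter_cons_eq {T : Type*} [DecidableEq T] {n : ℕ} (t : T) (a : Fin n → T)
    (u : T) : (Finset.univ.filter fun k => (Fin.cons t a : Fin (n + 1) → T) k = u).card =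
      (if t = u then 1 else 0) + (Finset.univ.filter fun k => a k = u).card := by
  rw [Finset.card_filter, Finset.card_filter, Fin.sum_univ_succ]
  simp

/-- The number of maps `Fin n → T` with prescribed sizes of the fibres over the points `e i`. -/
theorem card_fiber_card_eq_mul_prod_factorial {T ι : Type*} [Fintype T] [DecidableEq T]
    [Fintype ι] [DecidableEq ι] (e : ι → T) (he : Function.Injective e) (n : ℕ) (x : ι → ℕ) :
    Fintype.card {a : Fin n → T // ∀ i, (Finset.univ.filter fun k => a k = e i).card = x i} *
      ∏ i, (x i).factorial =
    n.descFactorial (∑ i, x i) * (Fintype.card T - Fintype.card ι) ^ (n - ∑ i, x i) := by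
  induction n generalizing x with
  | zero =>
    by_cases hx : x = 0
    · subst hx; simp
    · have h1 : 0 < ∑ i, x i := by
        obtain ⟨i, hi⟩ := Function.ne_iff.mp hx
        exact (Nat.pos_of_ne_zero hi).trans_le
          (Finset.single_le_sum (f := x) (fun _ _ => Nat.zero_le _) (Finset.mem_univ i))
      rw [Nat.descFactorial_of_lt h1, zero_mul, mul_eq_zero]
      left
      rw [Fintype.card_eq_zero_iff]
      refine ⟨fun a => hx (funext fun i => ?_)⟩
      simpa using (a.2 i).symm
  | succ n ih =>
    set C : (ι → ℕ) → ℕ := fun x => Fintype.card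
      {a : Fin n → T // ∀ i, (Finset.univ.filter fun k => a k = e i).card = x i} with hC
    -- Classify maps by the value at the first key: outside the image of `e` the prescription stays
    -- `x`, while at `e j` it drops by one at `j`.
    have split : Fintype.card {a : Fin (n + 1) → T //
        ∀ i, (Finset.univ.filter fun k => a k = e i).card = x i} =
        ∑ t : T, Fintype.card {a : Fin n → T // ∀ i, (if t = e i then 1 else 0) +
          (Finset.univ.filter fun k => a k = e i).card = x i} := by
      rw [← Fintype.card_sigma]
      refine Fintype.card_congr ?_
      refine ⟨fun a => ⟨a.1 0, Fin.tail a.1, fun i => ?_⟩, fun a => ⟨Fin.cons a.1 a.2.1, fun i => ?_⟩,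
        fun a => ?_, fun a => ?_⟩
      · rw [← Fin.card_filter_cons_eq, Fin.cons_self_tail]
        exact a.2 i
      · rw [Fin.card_filter_cons_eq]
        exact a.2.2 i
      · simp
      · rfl
    have off : ∀ t ∉ Finset.univ.image e, Fintype.card {a : Fin n → T //
        ∀ i, (if t = e i then 1 else 0) +
          (Finset.univ.filter fun k => a k = e i).card = x i} = C x := by
      intro t ht
      have : ∀ i, t ≠ e i := fun i h => ht (by simp [h])
      simp only [hC, this, if_false, zero_add]
    have on : ∀ j, Fintype.card {a : Fin n → T //
        ∀ i, (if e j = e i then 1 else 0) +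
          (Finset.univ.filter fun k => a k = e i).card = x i} * ∏ i, (x i).factorial =
        x j * (n.descFactorial (∑ i, x i - 1) *
          (Fintype.card T - Fintype.card ι) ^ (n + 1 - ∑ i, x i)) := by
      intro j
      rcases Nat.eq_zero_or_pos (x j) with hj | hj
      · rw [hj, zero_mul, mul_eq_zero]
        left
        rw [Fintype.card_eq_zero_iff]
        refine ⟨fun a => ?_⟩
        have := a.2 j
        rw [hj, if_pos rfl] at this
        omega
      · have hs : ∑ i, x i = ∑ i, Function.update x j (x j - 1) i + 1 := by
          rw [Finset.sum_update_of_mem (Finset.mem_univ j),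
            ← Finset.add_sum_erase _ _ (Finset.mem_univ j), Finset.sdiff_singleton_eq_erase]
          omega
        have hp : ∏ i, (x i).factorial =
            x j * ∏ i, (Function.update x j (x j - 1) i).factorial := by
          rw [← Finset.mul_prod_erase _ _ (Finset.mem_univ j),
            ← Finset.mul_prod_erase _ (fun i => (Function.update x j (x j - 1) i).factorial)
              (Finset.mem_univ j), Function.update_self, ← mul_assoc,
            Nat.mul_factorial_pred hj.ne']
          congr 1
          refine Finset.prod_congr rfl fun i hi => ?_
          rw [Function.update_of_ne (Finset.ne_of_mem_erase hi)]
        have hc : Fintype.card {a : Fin n → T //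
            ∀ i, (if e j = e i then 1 else 0) +
              (Finset.univ.filter fun k => a k = e i).card = x i} =
            C (Function.update x j (x j - 1)) := by
          refine Fintype.card_congr (Equiv.subtypeEquivRight fun a => forall_congr' fun i => ?_)
          by_cases hij : i = j
          · subst hij
            rw [Function.update_self, if_pos rfl]
            omega
          · rw [Function.update_of_ne hij, if_neg fun h => hij (he h).symm, zero_add]
        rw [hc, hp, mul_left_comm, ih, hs]
        simp
    rw [split, Finset.sum_mul, ← Finset.sum_add_sum_compl (Finset.univ.image e),
      Finset.sum_image he.injOn]
    simp_rw [on]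
    have rest : ∑ t ∈ (Finset.univ.image e)ᶜ, Fintype.card {a : Fin n → T //
        ∀ i, (if t = e i then 1 else 0) +
          (Finset.univ.filter fun k => a k = e i).card = x i} * ∏ i, (x i).factorial =
        (Fintype.card T - Fintype.card ι) * (n.descFactorial (∑ i, x i) *
          (Fintype.card T - Fintype.card ι) ^ (n - ∑ i, x i)) := by
      rw [← ih, ← Finset.card_univ (α := ι), ← Finset.card_image_of_injective _ he,
        ← Finset.card_compl, ← smul_eq_mul, ← Finset.sum_const]
      exact Finset.sum_congr rfl fun t ht => by rw [off t (Finset.mem_compl.mp ht)]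
    rw [rest, ← Finset.sum_mul]
    generalize ∑ i, x i = s
    generalize Fintype.card T - Fintype.card ι = w
    -- What remains is the Pascal-type recursion for falling factorials; the cases are forced by
    -- truncated subtraction in the exponents.
    rcases s with _ | s
    · simp [pow_succ']
    · rw [Nat.succ_descFactorial_succ, Nat.add_sub_cancel, Nat.add_sub_add_right]
      rcases lt_or_ge n (s + 1) with h | h
      · rw [Nat.descFactorial_of_lt h]
        rcases Nat.lt_succ_iff.mp h |>.lt_or_eq with h' | rfl
        · simp [Nat.descFactorial_of_lt h']
        · ring
      · obtain ⟨d, rfl⟩ : ∃ d, n = s + 1 + d := ⟨n - (s + 1), by omega⟩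
        rw [Nat.descFactorial_succ, show s + 1 + d - s = d + 1 by omega,
          show s + 1 + d - (s + 1) = d by omega]
        ring

theorem sum_addressCount {m n : ℕ} [NeZero m] (a : Fin n → ZMod m) (i : ℤ) :
    ∑ k ∈ Finset.range m, addressCount a (i - k) = n := by
  have h : ∀ k : ℕ, addressCount a (i - k) =
      ∑ j : Fin n, if a j = ((i - k : ℤ) : ZMod m) then 1 else 0 := fun k => by
    rw [addressCount, Finset.card_filter]
  simp_rw [h]
  rw [Finset.sum_comm]
  trans ∑ j : Fin n, 1
  · refine Finset.sum_congr rfl fun j _ => ?_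
    rw [Finset.sum_eq_single (((i : ZMod m) - a j).val)]
    · rw [if_pos]; push_cast; rw [ZMod.natCast_zmod_val]; ring
    · intro k hk hne
      rw [if_neg]
      intro h
      apply hne
      rw [h]
      push_cast
      rw [sub_sub_cancel, ZMod.val_natCast, Nat.mod_eq_of_lt (Finset.mem_range.mp hk)]
    · intro h
      exact absurd (Finset.mem_range.mpr (ZMod.val_lt _)) h
  · simp

theorem excess_addressCount {m n : ℕ} [NeZero m] (b : ℕ) (a : Fin n → ZMod m) (i : ℤ) :
    excess b (addressCount a) i m = n - b * m := by
  have := sum_addressCount a i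
  rw [excess, Finset.sum_sub_distrib, ← Nat.cast_sum, this]
  simp [mul_comm]

theorem periodic_addressCount {m n : ℕ} (a : Fin n → ZMod m) :
    Function.Periodic (addressCount a) m := by
  intro i
  simp [addressCount]

theorem isHashTable_addressCount {b m n : ℕ} [NeZero m] (h : n < b * m) (a : Fin n → ZMod m) :
    IsHashTable b m (addressCount a) where
  ne_zero := by simpa using NeZero.ne m
  periodic k hk := by
    obtain rfl : m = k := by exact_mod_cast hk
    exact periodic_addressCount a
  load := by
    refine loadCondition_of_periodic (m := m) (periodic_addressCount a) ?_
    rw [excess_addressCount]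
    have : (n : ℤ) < b * m := by exact_mod_cast h
    omega

/-- Keys are independent, so the sum factorises: each key has `L` addresses of weight `s` and `m -
L` of weight `1`. The bound `L ≤ m` keeps the addresses distinct. -/
theorem sum_pow_addressCount {m n L : ℕ} [NeZero m] (hL : L ≤ m) (i : ℤ) (s : ℝ) :
    ∑ a : Fin n → ZMod m, s ^ ∑ k ∈ Finset.range L, addressCount a (i - k) =
      (m + L * (s - 1)) ^ n := by
  have h1 : ∀ a : Fin n → ZMod m, s ^ ∑ k ∈ Finset.range L, addressCount a (i - k) =
      ∏ j, ∏ k ∈ Finset.range L, if a j = ((i - k : ℤ) : ZMod m) then s else 1 := by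
    intro a
    rw [Finset.prod_comm, ← Finset.prod_pow_eq_pow_sum]
    refine Finset.prod_congr rfl fun k _ => ?_
    rw [addressCount, Finset.prod_ite]
    simp
  have h2 : ∀ z : ZMod m, (∏ k ∈ Finset.range L, if z = ((i - k : ℤ) : ZMod m) then s else 1) =
      1 + ∑ k ∈ Finset.range L, if z = ((i - k : ℤ) : ZMod m) then s - 1 else 0 := by
    intro z
    have inj : ∀ k ∈ Finset.range L, ∀ k' ∈ Finset.range L, z = ((i - k : ℤ) : ZMod m) →
        z = ((i - k' : ℤ) : ZMod m) → k = k' := by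
      intro k hk k' hk' h h'
      have h3 : (k : ZMod m) = k' := by
        rw [h] at h'; push_cast at h'; exact sub_right_injective h'
      rw [ZMod.natCast_eq_natCast_iff] at h3
      exact Nat.ModEq.eq_of_lt_of_lt h3 ((Finset.mem_range.mp hk).trans_le hL)
        ((Finset.mem_range.mp hk').trans_le hL)
    by_cases hz : ∃ k ∈ Finset.range L, z = ((i - k : ℤ) : ZMod m)
    · obtain ⟨k, hk, hzk⟩ := hz
      rw [Finset.prod_eq_single_of_mem k hk, Finset.sum_eq_single_of_mem k hk, if_pos hzk,
        if_pos hzk]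
      · ring
      · exact fun k' hk' hne => if_neg fun h => hne (inj k' hk' k hk h hzk)
      · exact fun k' hk' hne => if_neg fun h => hne (inj k' hk' k hk h hzk)
    · push Not at hz
      rw [Finset.prod_eq_one fun k hk => if_neg (hz k hk),
        Finset.sum_eq_zero fun k hk => if_neg (hz k hk), add_zero]
  simp_rw [h1, h2]
  rw [← Fintype.sum_pow (fun z : ZMod m =>
    1 + ∑ k ∈ Finset.range L, if z = ((i - k : ℤ) : ZMod m) then s - 1 else 0),
    Finset.sum_add_distrib, Finset.sum_comm]
  simp [ZMod.card]
  ring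

/-! ### Asymptotics of the exact model -/

/-- Chernoff bound: weight each assignment by `s ^ (keys in the stretch)` and use `1 + x ≤ exp x`.
The choice `s = β⁻¹` minimises `exp (bβ(s - 1)) / s ^ b`. -/
theorem card_excess_pos_le {b m n L : ℕ} [NeZero m] {β : ℝ} (hβ : 0 < β) (hβ1 : β < 1)
    (hn : (n : ℝ) ≤ β * (b * m)) (hL : L ≤ m) (i : ℤ) :
    ((Finset.univ.filter fun a : Fin n → ZMod m => 0 < excess b (addressCount a) i L).card : ℝ) ≤
      ((β * Real.exp (1 - β)) ^ b) ^ L * m ^ n := by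
  have hm : (0 : ℝ) < m := by exact_mod_cast NeZero.pos m
  set S := Finset.univ.filter fun a : Fin n → ZMod m => 0 < excess b (addressCount a) i L
  have hs : 1 ≤ β⁻¹ := (one_le_inv₀ hβ).mpr hβ1.le
  have h1 : (S.card : ℝ) * β⁻¹ ^ (b * L) ≤ (m + L * (β⁻¹ - 1)) ^ n := by
    rw [← sum_pow_addressCount hL i, ← nsmul_eq_mul, ← Finset.sum_const]
    refine (Finset.sum_le_sum fun a ha => ?_).trans
      (Finset.sum_le_sum_of_subset_of_nonneg (Finset.subset_univ S) fun a _ _ => by positivity)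
    refine pow_le_pow_right₀ hs ?_
    have := (Finset.mem_filter.mp ha).2
    rw [excess, Finset.sum_sub_distrib, ← Nat.cast_sum] at this
    simp only [Finset.sum_const, Finset.card_range, nsmul_eq_mul] at this
    have h2 : ((b * L : ℕ) : ℤ) ≤
        ((∑ k ∈ Finset.range L, addressCount a (i - k) : ℕ) : ℤ) := by
      push_cast at this ⊢; linarith
    exact_mod_cast h2
  have h2 : (m + L * (β⁻¹ - 1)) ^ n ≤ m ^ n * Real.exp (b * (1 - β) * L) := by
    have e1 : m + L * (β⁻¹ - 1) = m * (1 + L * (β⁻¹ - 1) / m) := by field_simp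
    have e2 : 0 ≤ L * (β⁻¹ - 1) / m := by
      have := sub_nonneg.mpr hs
      positivity
    rw [e1, mul_pow]
    gcongr
    calc (1 + L * (β⁻¹ - 1) / m) ^ n ≤ Real.exp (L * (β⁻¹ - 1) / m) ^ n := by
          gcongr
          rw [add_comm]
          exact Real.add_one_le_exp _
      _ = Real.exp (n * (L * (β⁻¹ - 1) / m)) := (Real.exp_nat_mul _ _).symm
      _ ≤ Real.exp (β * (b * m) * (L * (β⁻¹ - 1) / m)) := by gcongr
      _ = _ := by congr 1; field_simp
  have h3 : (0 : ℝ) < β⁻¹ ^ (b * L) := by positivity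
  rw [← le_div_iff₀ h3] at h1
  refine h1.trans ((div_le_div_of_nonneg_right h2 h3.le).trans_eq ?_)
  rw [mul_pow, mul_pow, ← pow_mul, ← pow_mul, ← Real.exp_nat_mul, inv_pow, div_inv_eq_mul]
  push_cast
  rw [show (b * L : ℝ) * (1 - β) = b * (1 - β) * L by ring]
  ring

/-- There is a stretch of `L ≥ L₀` buckets, ending at some `i ∈ [-N - 1, N]` and shorter than the
whole cycle, with more than `b * L` keys. -/
def HasLongOverload (b m N L₀ : ℕ) (X : ℤ → ℕ) : Prop :=
  ∃ i ∈ Finset.Icc (-N - 1 : ℤ) N, ∃ L, L₀ ≤ L ∧ L < m ∧ 0 < excess b X i L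

open Classical in
theorem tsum_uniform_hasLongOverload_le {b m n N L₀ : ℕ} [NeZero m] {β : ℝ} (hβ : 0 < β)
    (hβ1 : β < 1) (hn : (n : ℝ) ≤ β * (b * m)) :
    ∑' a, PMF.uniformOfFintype (Fin n → ZMod m) a *
      (if HasLongOverload b m N L₀ (addressCount a) then 1 else 0) ≤
    (2 * N + 2 : ℕ) * (ENNReal.ofReal ((β * Real.exp (1 - β)) ^ b) ^ L₀ *
      (1 - ENNReal.ofReal ((β * Real.exp (1 - β)) ^ b))⁻¹) := by
  set c := ENNReal.ofReal ((β * Real.exp (1 - β)) ^ b) with hc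
  have single : ∀ i : ℤ, ∀ L < m, ∑' a, PMF.uniformOfFintype (Fin n → ZMod m) a *
      (if 0 < excess b (addressCount a) i L then 1 else 0) ≤ c ^ L := by
    intro i L hL
    have h := card_excess_pos_le hβ hβ1 hn hL.le i
    have hm : ((m : ENNReal) ^ n) ≠ 0 := by
      have := NeZero.ne m
      positivity
    have hm' : ((m : ENNReal) ^ n) ≠ ⊤ := by finiteness
    simp only [PMF.uniformOfFintype_apply, Fintype.card_fun, ZMod.card, Fintype.card_fin,
      tsum_fintype, mul_ite, mul_one, mul_zero]
    rw [← Finset.sum_filter, Finset.sum_const, nsmul_eq_mul]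
    push_cast
    rw [← div_eq_mul_inv, ENNReal.div_le_iff hm hm', hc, ← ENNReal.ofReal_pow (by positivity),
      ← ENNReal.ofReal_natCast, ← ENNReal.ofReal_natCast m, ← ENNReal.ofReal_pow (by positivity),
      ← ENNReal.ofReal_mul (by positivity)]
    exact ENNReal.ofReal_le_ofReal h
  -- Union bound over `2N + 2` endpoints and lengths `L₀ + d`; extending the sum to all `d` gives a
  -- geometric series independent of `m` and `n`.
  have union : ∀ a : Fin n → ZMod m,
      (if HasLongOverload b m N L₀ (addressCount a) then 1 else 0 : ENNReal) ≤
      ∑ i ∈ Finset.Icc (-N - 1 : ℤ) N, ∑' d : ℕ, if L₀ + d < m then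
        (if 0 < excess b (addressCount a) i (L₀ + d) then 1 else 0) else 0 := by
    intro a
    split_ifs with h
    · obtain ⟨i, hi, L, hL, hL', h⟩ := h
      obtain ⟨d, rfl⟩ := Nat.exists_eq_add_of_le hL
      refine le_trans ?_ (Finset.single_le_sum (fun _ _ => zero_le) hi)
      refine le_trans ?_ (ENNReal.le_tsum d)
      simp [hL', h]
    · exact zero_le
  calc _ ≤ ∑' a, PMF.uniformOfFintype (Fin n → ZMod m) a *
        ∑ i ∈ Finset.Icc (-N - 1 : ℤ) N, ∑' d : ℕ, if L₀ + d < m then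
          (if 0 < excess b (addressCount a) i (L₀ + d) then 1 else 0) else 0 := by
        gcongr with a
        exact union a
    _ = ∑ i ∈ Finset.Icc (-N - 1 : ℤ) N, ∑' d : ℕ, ∑' a,
        PMF.uniformOfFintype (Fin n → ZMod m) a * if L₀ + d < m then
          (if 0 < excess b (addressCount a) i (L₀ + d) then 1 else 0) else 0 := by
        simp_rw [Finset.mul_sum, ← ENNReal.tsum_mul_left]
        rw [Summable.tsum_finsetSum fun _ _ => ENNReal.summable]
        refine Finset.sum_congr rfl fun i _ => ENNReal.tsum_comm
    _ ≤ ∑ i ∈ Finset.Icc (-N - 1 : ℤ) N, ∑' d : ℕ, c ^ (L₀ + d) := by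
        gcongr with i hi d
        split_ifs with h
        · exact single i _ h
        · simp
    _ = _ := by
        simp_rw [pow_add, ENNReal.tsum_mul_left, ENNReal.tsum_geometric]
        rw [Finset.sum_const, nsmul_eq_mul, Int.card_Icc]
        congr 2
        omega

/-- A stretch reaching beyond `-K` from an end `i ≥ -N - 1` has length at least `K - N`. If it is
shorter than `m` it is not overloaded; longer ones reduce by periods. -/
theorem profile_cutoff_addressCount {b m n N K : ℕ} [NeZero m] (hn : n ≤ b * m) (hK : N < K)
    {a : Fin n → ZMod m} (h : ¬ HasLongOverload b m N (K - N) (addressCount a)) {i : ℤ}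
    (hi : |i| ≤ N) : profile b (cutoff K (addressCount a)) i = profile b (addressCount a) i := by
  refine profile_cutoff hK (fun i h1 h2 L hL => ?_) hi
  obtain ⟨L', h3, h4⟩ := exists_excess_le_of_periodic (b := b) (L₀ := (i + K + 1).toNat) (i := i)
    (NeZero.pos m)
    (periodic_addressCount a) (by
      rw [excess_addressCount]
      have : (n : ℤ) ≤ b * m := by exact_mod_cast hn
      omega)
    (fun L h3 h4 => by
      by_contra! h5
      exact h ⟨i, Finset.mem_Icc.mpr ⟨h1, h2⟩, L, by omega, h4, h5⟩) L
  exact ⟨L', by omega, h4⟩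

theorem tendsto_descFactorial_div_pow {ι : Type*} {l : Filter ι} {m n : ι → ℕ} {t : ℝ}
    (ht : 0 ≤ t)
    (hm : Tendsto m l atTop) (hn : Tendsto (fun k => (n k : ℝ) / m k) l (𝓝 t)) (s : ℕ) :
    Tendsto (fun k => ((n k).descFactorial s : ℝ) / m k ^ s) l (𝓝 (t ^ s)) := by
  have hm' : Tendsto (fun k => (m k : ℝ)) l atTop := tendsto_natCast_atTop_atTop.comp hm
  induction s with
  | zero => simpa using tendsto_const_nhds
  | succ s ih =>
    have h1 : Tendsto (fun k => ((n k - s : ℕ) : ℝ) / m k) l (𝓝 t) := by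
      -- The maximum with `0` models the truncated difference `n k - s`.
      have h2 : Tendsto (fun k => max ((n k : ℝ) / m k - s / m k) 0) l (𝓝 (max (t - 0) 0)) :=
        (hn.sub (hm'.const_div_atTop _)).max tendsto_const_nhds
      rw [sub_zero, max_eq_left ht] at h2
      refine h2.congr fun k => ?_
      rw [← sub_div]
      rcases le_total s (n k) with h | h
      · rw [Nat.cast_sub h, max_eq_left]
        have : (s : ℝ) ≤ n k := by exact_mod_cast h
        have := sub_nonneg.mpr this
        positivity
      · rw [Nat.sub_eq_zero_of_le h, max_eq_right]
        · simp
        · have : (n k : ℝ) ≤ s := by exact_mod_cast h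
          exact div_nonpos_of_nonpos_of_nonneg (by linarith) (by positivity)
    refine (h1.mul ih).congr' (Eventually.of_forall fun k => ?_) |>.trans (by rw [pow_succ'])
    simp only [Nat.descFactorial_succ, Nat.cast_mul, pow_succ']
    rw [div_mul_div_comm]

theorem tendsto_one_sub_div_pow {ι : Type*} {l : Filter ι} {m n : ι → ℕ} {t : ℝ}
    (hm : Tendsto m l atTop) (hn : Tendsto (fun k => (n k : ℝ) / m k) l (𝓝 t)) (w : ℕ) :
    Tendsto (fun k => (1 - w / m k : ℝ) ^ n k) l (𝓝 (Real.exp (-(w * t)))) := by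
  have hm' : Tendsto (fun k => (m k : ℝ)) l atTop := tendsto_natCast_atTop_atTop.comp hm
  have h1 := (Real.tendsto_mul_log_one_add_div_atTop (-w)).comp hm'
  have h2 := (Real.continuous_exp.tendsto _).comp (hn.mul h1)
  rw [show t * -(w : ℝ) = -(w * t) by ring] at h2
  refine h2.congr' ?_
  filter_upwards [hm.eventually_gt_atTop w] with k hk
  have hk' : (w : ℝ) < m k := by exact_mod_cast hk
  have h0 : (0 : ℝ) < m k := lt_of_le_of_lt (by positivity) hk'
  have : 0 < 1 - (w : ℝ) / m k := by rw [sub_pos, div_lt_one h0]; exact hk'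
  simp only [Function.comp]
  rw [← Real.exp_log this, ← Real.exp_nat_mul, neg_div, ← sub_eq_add_neg]
  congr 1
  field_simp

/-- After division by the factorials, this is the probability of given counts, with sum `s`, at `w`
addresses; the limit is the corresponding product of Poisson weights. -/
theorem tendsto_descFactorial_mul_pow_div {ι : Type*} {l : Filter ι} {m n : ι → ℕ} {t : ℝ}
    (ht : 0 ≤ t) (hm : Tendsto m l atTop) (hn : Tendsto (fun k => (n k : ℝ) / m k) l (𝓝 t))
    (s w : ℕ) :
    Tendsto (fun k => (((n k).descFactorial s * (m k - w) ^ (n k - s) : ℕ) : ℝ) / m k ^ n k) l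
      (𝓝 (t ^ s * Real.exp (-(w * t)))) := by
  have hm' : Tendsto (fun k => (m k : ℝ)) l atTop := tendsto_natCast_atTop_atTop.comp hm
  have h1 : Tendsto (fun k => (1 - w / m k : ℝ) ^ s) l (𝓝 ((1 - 0) ^ s)) :=
    (tendsto_const_nhds.sub (hm'.const_div_atTop _)).pow s
  have h2 := (tendsto_descFactorial_div_pow ht hm hn s).mul
    ((tendsto_one_sub_div_pow hm hn w).div h1 (by simp))
  rw [sub_zero, one_pow, div_one] at h2
  refine h2.congr' ?_
  filter_upwards [hm.eventually_gt_atTop w] with k hk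
  have hk' : (w : ℝ) < m k := by exact_mod_cast hk
  have h0 : (0 : ℝ) < m k := lt_of_le_of_lt (by positivity) hk'
  have h3 : 0 < 1 - (w : ℝ) / m k := by rw [sub_pos, div_lt_one h0]; exact hk'
  simp only [Pi.div_apply]
  rcases lt_or_ge (n k) s with h | h
  · simp [Nat.descFactorial_of_lt h]
  · obtain ⟨d, hd⟩ := Nat.exists_eq_add_of_le h
    push_cast [Nat.cast_sub hk.le]
    rw [show (m k : ℝ) - w = m k * (1 - w / m k) by field_simp, show n k - s = d by omega, hd,
      pow_add, pow_add, mul_pow]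
    generalize 1 - (w : ℝ) / m k = y at h3
    field_simp

/-! ### The law of a window -/

open Classical in
theorem PMF.tsum_mul_comp_eq {A B : Type*} (p : PMF A) (r : A → B) (g : B → ENNReal) :
    ∑' a, p a * g (r a) = ∑' x, p.map r x * g x := by
  simp_rw [PMF.map_apply, ← ENNReal.tsum_mul_right]
  rw [ENNReal.tsum_comm]
  refine tsum_congr fun a => ?_
  rw [tsum_eq_single (r a)]
  · simp
  · intro x hx
    rw [if_neg hx, zero_mul]

theorem map_restrict_uniform_apply {m n K : ℕ} [NeZero m] (hm : 2 * K + 1 ≤ m)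
    (x : Finset.Icc (-(K : ℤ)) K → ℕ) :
    (PMF.uniformOfFintype (Fin n → ZMod m)).map
      (fun a => (Finset.Icc (-(K : ℤ)) K).restrict (addressCount a)) x =
    ENNReal.ofReal ((n.descFactorial (∑ i, x i) * (m - (2 * K + 1)) ^ (n - ∑ i, x i) : ℕ) /
      m ^ n / ∏ i, (x i).factorial) := by
  classical
  -- The window has `2K + 1 ≤ m` points, so it does not wrap around the cycle.
  have he : Function.Injective fun i : Finset.Icc (-(K : ℤ)) K => ((i : ℤ) : ZMod m) := by
    intro i j h
    have hi := Finset.mem_Icc.mp i.2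
    have hj := Finset.mem_Icc.mp j.2
    rw [ZMod.intCast_eq_intCast_iff_dvd_sub] at h
    have := Int.eq_zero_of_abs_lt_dvd h (abs_lt.mpr ⟨by omega, by omega⟩)
    exact Subtype.ext (by omega)
  have hc := card_fiber_card_eq_mul_prod_factorial _ he n x
  have hw : Fintype.card (Finset.Icc (-(K : ℤ)) K) = 2 * K + 1 := by
    rw [Fintype.card_coe, Int.card_Icc]
    omega
  rw [ZMod.card, hw] at hc
  have hm0 : (0 : ℝ) < m := by exact_mod_cast NeZero.pos m
  have hf : (0 : ℝ) < ∏ i, ((x i).factorial : ℝ) :=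
    Finset.prod_pos fun i _ => by exact_mod_cast (x i).factorial_pos
  have hmap : (PMF.uniformOfFintype (Fin n → ZMod m)).map
      (fun a => (Finset.Icc (-(K : ℤ)) K).restrict (addressCount a)) x =
      ∑ a with x = (Finset.Icc (-(K : ℤ)) K).restrict (addressCount a),
        PMF.uniformOfFintype (Fin n → ZMod m) a := by
    rw [PMF.map_apply, tsum_fintype, Finset.sum_filter]
    exact Finset.sum_congr rfl fun a _ => by congr
  rw [← hc, Nat.cast_mul, Nat.cast_prod, div_right_comm, mul_div_cancel_right₀ _ hf.ne',
    ENNReal.ofReal_div_of_pos (by positivity), ENNReal.ofReal_natCast,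
    ENNReal.ofReal_pow hm0.le, ENNReal.ofReal_natCast, hmap, Fintype.card_subtype]
  simp only [PMF.uniformOfFintype_apply, Fintype.card_fun, ZMod.card, Fintype.card_fin,
    Finset.sum_const, nsmul_eq_mul, Nat.cast_pow, div_eq_mul_inv]
  congr 3
  ext a
  simp only [Finset.mem_filter, funext_iff, Finset.restrict, addressCount]
  exact and_congr Iff.rfl (forall_congr' fun i => eq_comm)

theorem lintegral_restrict_poissonField {b : ℕ} {α : ℝ≥0} (I : Finset ℤ)
    (g : (I → ℕ) → ENNReal) :
    ∫⁻ X, g (I.restrict X) ∂poissonField b α =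
      ∑' x, ENNReal.ofReal (((b * α : ℝ≥0) : ℝ) ^ (∑ i, x i) *
        Real.exp (-(I.card * (b * α : ℝ≥0))) / ∏ i, (x i).factorial) * g x := by
  rw [← lintegral_map (f := g) (measurable_of_countable g) (Finset.measurable_restrict I),
    poissonField, Measure.infinitePi_map_restrict, lintegral_countable']
  refine tsum_congr fun x => ?_
  rw [mul_comm, Measure.pi_singleton]
  simp_rw [poissonMeasure_singleton]
  rw [← ENNReal.ofReal_prod_of_nonneg fun _ _ => by positivity]
  congr 2
  rw [Finset.prod_div_distrib, Finset.prod_mul_distrib, Finset.prod_const,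
    Finset.prod_pow_eq_pow_sum, ← Real.exp_nat_mul, Finset.card_univ, Fintype.card_coe, mul_comm]
  congr 3
  ring

/-- Convergence of finite windows of the exact model to the Poisson model, in the form of a lower
bound. -/
theorem lintegral_restrict_poissonField_le_liminf {b : ℕ} (hb : 1 ≤ b) {α : ℝ≥0} {m n : ℕ → ℕ}
    (hm : Tendsto m atTop atTop)
    (hn : Tendsto (fun k => (n k : ℝ) / (b * m k)) atTop (𝓝 (α : ℝ))) (K : ℕ)
    (g : (Finset.Icc (-(K : ℤ)) K → ℕ) → ENNReal) (F : ℕ → ENNReal)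
    (hF : ∀ᶠ k in atTop, ∀ h : m k ≠ 0, haveI : NeZero (m k) := ⟨h⟩
      ∑' a, PMF.uniformOfFintype (Fin (n k) → ZMod (m k)) a *
        g ((Finset.Icc (-(K : ℤ)) K).restrict (addressCount a)) ≤ F k) :
    ∫⁻ X, g ((Finset.Icc (-(K : ℤ)) K).restrict X) ∂poissonField b α ≤ liminf F atTop := by
  have hb' : (b : ℝ) ≠ 0 := by positivity
  have hn' : Tendsto (fun k => (n k : ℝ) / m k) atTop (𝓝 (b * α : ℝ≥0)) := by
    push_cast
    refine (hn.const_mul (b : ℝ)).congr fun k => ?_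
    field_simp
  set v : ℕ → (Finset.Icc (-(K : ℤ)) K → ℕ) → ENNReal := fun k x => ENNReal.ofReal
    (((n k).descFactorial (∑ i, x i) * (m k - (2 * K + 1)) ^ (n k - ∑ i, x i) : ℕ) /
      m k ^ n k / ∏ i, (x i).factorial) * g x with hv
  have hcard : (Finset.Icc (-(K : ℤ)) K).card = 2 * K + 1 := by rw [Int.card_Icc]; omega
  calc _ = ∫⁻ x, ENNReal.ofReal (((b * α : ℝ≥0) : ℝ) ^ (∑ i, x i) *
        Real.exp (-((2 * K + 1 : ℕ) * (b * α : ℝ≥0))) / ∏ i, (x i).factorial) * g x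
        ∂Measure.count := by
        rw [lintegral_restrict_poissonField, lintegral_count, hcard]
    -- Weights converge pointwise. Since `g x` may be infinite, a zero limiting weight is treated
    -- separately.
    _ ≤ ∫⁻ x, liminf (fun k => v k x) atTop ∂Measure.count := by
        refine lintegral_mono fun x => ?_
        have h1 := (tendsto_descFactorial_mul_pow_div (by positivity) hm hn' (∑ i, x i)
          (2 * K + 1)).div_const (∏ i, ((x i).factorial : ℝ))
        have h2 := (ENNReal.continuous_ofReal.tendsto _).comp h1
        by_cases h0 : ENNReal.ofReal (((b * α : ℝ≥0) : ℝ) ^ (∑ i, x i) *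
          Real.exp (-((2 * K + 1 : ℕ) * (b * α : ℝ≥0))) / ∏ i, ((x i).factorial : ℝ)) = 0
        · simp only [h0, zero_mul, zero_le]
        · refine ((ENNReal.Tendsto.mul_const h2 (Or.inl h0)).liminf_eq).symm.le.trans ?_
          simp [hv]
    _ ≤ liminf (fun k => ∫⁻ x, v k x ∂Measure.count) atTop :=
        lintegral_liminf_le fun k => measurable_of_countable _
    _ ≤ liminf F atTop := by
        refine liminf_le_liminf ?_
        filter_upwards [hF, hm.eventually_ge_atTop (2 * K + 1)] with k hk hmk
        have h0 : m k ≠ 0 := by omega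
        have : NeZero (m k) := ⟨h0⟩
        refine le_trans (le_of_eq ?_) (hk h0)
        rw [PMF.tsum_mul_comp_eq _ fun a => (Finset.Icc (-(K : ℤ)) K).restrict (addressCount a),
          lintegral_count]
        refine tsum_congr fun x => ?_
        rw [map_restrict_uniform_apply hmk]

/-! ### The Poisson model -/

instance {b : ℕ} {α : ℝ≥0} : IsProbabilityMeasure (poissonField b α) := by
  unfold poissonField
  infer_instance

/-- The factorial moments of the Poisson distribution. -/
theorem hasSum_poisson_mul_descFactorial (r : ℝ) (j : ℕ) :
    HasSum (fun n : ℕ => Real.exp (-r) * r ^ n / n.factorial * n.descFactorial j) (r ^ j) := by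
  have h0 : HasSum (fun n : ℕ => r ^ n / (n.factorial : ℝ)) (Real.exp r) := by
    rw [Real.exp_eq_exp_ℝ]; exact NormedSpace.expSeries_div_hasSum_exp r
  rw [← hasSum_nat_add_iff' j, Finset.sum_eq_zero fun i hi => by
    rw [Nat.descFactorial_of_lt (Finset.mem_range.mp hi), Nat.cast_zero, mul_zero], sub_zero]
  have h1 := h0.mul_left (Real.exp (-r) * r ^ j)
  rw [mul_right_comm, ← Real.exp_add, neg_add_cancel, Real.exp_zero, one_mul] at h1
  refine h1.congr_fun fun n => ?_
  have h2 := Nat.factorial_mul_descFactorial (Nat.le_add_left j n)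
  rw [Nat.add_sub_cancel] at h2
  rw [← h2]
  have h3 : ((n + j).descFactorial j : ℝ) ≠ 0 := by
    exact_mod_cast (Nat.descFactorial_pos.mpr (Nat.le_add_left j n)).ne'
  push_cast
  field_simp
  ring

theorem hasSum_poisson_mul_self (r : ℝ) :
    HasSum (fun n : ℕ => Real.exp (-r) * r ^ n / n.factorial * n) r := by
  simpa using hasSum_poisson_mul_descFactorial r 1

/-- The variance of the Poisson distribution. -/
theorem hasSum_poisson_mul_sub_sq (r : ℝ) :
    HasSum (fun n : ℕ => Real.exp (-r) * r ^ n / n.factorial * (n - r) ^ 2) r := by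
  -- Uses `(n - r)² = n(n - 1) + (1 - 2r)n + r²`.
  have h := ((hasSum_poisson_mul_descFactorial r 2).add
    ((hasSum_poisson_mul_self r).mul_left (1 - 2 * r))).add
    ((hasSum_poisson_mul_descFactorial r 0).mul_left (r ^ 2))
  convert h using 1
  · funext n
    have : (n.descFactorial 2 : ℝ) = n * (n - 1) := by
      rcases n with _ | n
      · simp
      · simp [Nat.descFactorial_succ, mul_comm]
    rw [this, Nat.descFactorial_zero]
    push_cast
    ring
  · ring

theorem integral_poissonMeasure_natCast (r : ℝ≥0) : ∫ n, (n : ℝ) ∂poissonMeasure r = r := by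
  rw [integral_poissonMeasure]
  simpa using (hasSum_poisson_mul_self r).tsum_eq

/-- By the strong law the averages of `b - X_{-i}` tend to `b(1 - α) > 0`. -/
theorem ae_loadCondition_poissonField {b : ℕ} (hb : 1 ≤ b) {α : ℝ≥0} (hα : α < 1) :
    ∀ᵐ X ∂poissonField b α, LoadCondition b X := by
  have hident : ∀ i : ℤ, (poissonField b α).map (fun X => X i) = poissonMeasure (b * α) :=
    fun i => Measure.infinitePi_map_eval _ i
  have hmeas : ∀ i : ℤ, Measurable fun X : ℤ → ℕ => (X i : ℝ) := fun i =>
    (measurable_of_countable _).comp (measurable_pi_apply i)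
  have hint : Integrable (fun X : ℤ → ℕ => (X (-((0 : ℕ) : ℤ)) : ℝ)) (poissonField b α) := by
    refine Integrable.comp_measurable (f := fun X : ℤ → ℕ => X (-((0 : ℕ) : ℤ)))
      (g := fun n : ℕ => (n : ℝ)) ?_ (measurable_pi_apply _)
    rw [hident, integrable_poissonMeasure_iff]
    simpa using (hasSum_poisson_mul_self _).summable
  have hindep : iIndepFun (fun (i : ℤ) (X : ℤ → ℕ) => (X i : ℝ)) (poissonField b α) :=
    iIndepFun_infinitePi (X := fun _ (n : ℕ) => (n : ℝ)) fun _ =>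
      measurable_of_countable fun n : ℕ => (n : ℝ)
  have hlaw := strong_law_ae_real (μ := poissonField b α)
    (fun (i : ℕ) (X : ℤ → ℕ) => (X (-(i : ℤ)) : ℝ)) hint
    (fun i j hij => hindep.indepFun fun h => hij (by simpa using h))
    (fun i => {
      aemeasurable_fst := (hmeas _).aemeasurable
      aemeasurable_snd := (hmeas _).aemeasurable
      map_eq := by
        have : ∀ j : ℤ, (poissonField b α).map (fun X : ℤ → ℕ => (X j : ℝ)) =
            (poissonMeasure (b * α)).map (fun n : ℕ => (n : ℝ)) := fun j => by
          rw [← hident j]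
          exact (Measure.map_map (g := fun n : ℕ => (n : ℝ)) (f := fun X : ℤ → ℕ => X j)
            (measurable_of_countable _) (measurable_pi_apply j)).symm
        rw [this, this] })
  have hmean : ∫ X, (X (-((0 : ℕ) : ℤ)) : ℝ) ∂poissonField b α = b * α := by
    rw [← integral_map (φ := fun X : ℤ → ℕ => X (-((0 : ℕ) : ℤ))) (f := fun n : ℕ => (n : ℝ))
      (measurable_pi_apply _).aemeasurable (measurable_of_countable fun n : ℕ => (n : ℝ)).aestronglyMeasurable,
      hident, integral_poissonMeasure_natCast]
    push_cast
    rfl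
  filter_upwards [hlaw] with X hX
  rw [hmean] at hX
  have hpos : 0 < (b : ℝ) - b * α := by
    have h1 : (α : ℝ) < 1 := by exact_mod_cast hα
    have h2 : (0 : ℝ) < b := by positivity
    nlinarith
  have h1 := (tendsto_const_nhds (x := (b : ℝ))).sub hX
  have h2 := h1.pos_mul_atTop hpos (tendsto_natCast_atTop_atTop (R := ℝ))
  unfold LoadCondition
  rw [← tendsto_intCast_atTop_iff (R := ℝ)]
  refine h2.congr' ?_
  filter_upwards [eventually_ne_atTop 0] with N hN
  push_cast
  rw [Finset.sum_sub_distrib]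
  simp only [Finset.sum_const, Finset.card_range, nsmul_eq_mul]
  have : (N : ℝ) ≠ 0 := by exact_mod_cast hN
  field_simp

theorem measurable_excess (b : ℕ) (i : ℤ) (L : ℕ) : Measurable fun X => excess b X i L := by
  refine Finset.measurable_sum _ fun k _ => ?_
  exact (measurable_of_countable fun n : ℕ => (n : ℤ) - b).comp (measurable_pi_apply (i - k))

theorem measurable_profile (b : ℕ) : Measurable (profile b) := by
  refine measurable_pi_lambda _ fun i => (measurable_pi_apply i).add ?_
  exact (measurable_of_countable Int.toNat).comp
    (Measurable.iSup fun L => measurable_excess b (i - 1) L)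

/-! ### Convergence of the exact model to the Poisson model -/

/-- The least probability of `A` under `P` over all tables whose profile is `H` on `[-N, N]`. -/
noncomputable def localInf (b : ℕ) (P : ℕ∞ → (ℤ → ℕ) → PMF ℕ) (A : Set ℕ) (N : ℕ) (H : ℤ → ℕ) :
    ENNReal :=
  ⨅ (m : ℕ∞) (X : ℤ → ℕ) (_ : IsHashTable b m X) (_ : ∀ i : ℤ, |i| ≤ N → profile b X i = H i),
    (P m (profile b X)).toMeasure A

section localInf

variable {b : ℕ} {P : ℕ∞ → (ℤ → ℕ) → PMF ℕ} {A : Set ℕ} {N : ℕ}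

theorem localInf_le {m : ℕ∞} {X H : ℤ → ℕ} (hX : IsHashTable b m X)
    (h : ∀ i : ℤ, |i| ≤ N → profile b X i = H i) :
    localInf b P A N H ≤ (P m (profile b X)).toMeasure A :=
  iInf_le_of_le m <| iInf_le_of_le X <| iInf_le_of_le hX <| iInf_le _ h

theorem localInf_congr {H H' : ℤ → ℕ} (h : ∀ i : ℤ, |i| ≤ N → H i = H' i) :
    localInf b P A N H = localInf b P A N H' := by
  unfold localInf
  refine iInf_congr fun m => iInf_congr fun X => iInf_congr fun _ => iInf_congr_Prop ?_ fun _ => rfl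
  exact forall₂_congr fun i hi => by rw [h i hi]

/-- Only finitely many coordinates matter, so the map factors through a countable discrete space
although the infimum is uncountable. -/
theorem measurable_localInf : Measurable (localInf b P A N) := by
  have : localInf b P A N = (fun x => localInf b P A N (extendZero x)) ∘
      (Finset.Icc (-(N : ℤ)) N).restrict := by
    funext H
    exact localInf_congr fun i hi => (cutoff_of_abs_le H hi).symm
  rw [this]
  exact (measurable_of_countable _).comp (Finset.measurable_restrict _)

theorem isHashTable_top_of_loadCondition {X : ℤ → ℕ} (h : LoadCondition b X) :
    IsHashTable b ⊤ X where
  ne_zero := by simp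
  periodic k hk := by simp at hk
  load := h

theorem localInf_extendZero_le_one (hb : 1 ≤ b) {K : ℕ} (x : Finset.Icc (-(K : ℤ)) K → ℕ) :
    localInf b P A N (profile b (extendZero x)) ≤ 1 :=
  (localInf_le (isHashTable_top_extendZero hb x) fun _ _ => rfl).trans prob_le_one

end localInf

/-- One radius from local determinacy serves every `A`, so a single null set suffices. -/
theorem ae_eventually_localInf_eq {b : ℕ} (hb : 1 ≤ b) {α : ℝ≥0} (hα : α < 1)
    {P : ℕ∞ → (ℤ → ℕ) → PMF ℕ} (hP : IsLocallyDetermined b α P) :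
    ∀ᵐ X ∂poissonField b α, ∀ A : Set ℕ, ∀ᶠ N in atTop,
      localInf b P A N (profile b X) = (P ⊤ (profile b X)).toMeasure A := by
  filter_upwards [hP, ae_loadCondition_poissonField hb hα] with X hX hload A
  obtain ⟨N₀, hN₀⟩ := hX
  filter_upwards [eventually_ge_atTop N₀] with N hN
  refine le_antisymm (localInf_le (isHashTable_top_of_loadCondition hload) fun _ _ => rfl) ?_
  refine le_iInf fun m => le_iInf fun X' => le_iInf fun hX' => le_iInf fun h => ?_
  rw [hN₀ m X' hX' fun i hi => h i (hi.trans (by exact_mod_cast hN))]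

/-- No measurability of `P` is assumed; it comes from local determinacy, as an almost sure limit of
the measurable `localInf`. This makes the law of `P_α` well defined. -/
theorem aemeasurable_toMeasure_profile {b : ℕ} (hb : 1 ≤ b) {α : ℝ≥0} (hα : α < 1)
    {P : ℕ∞ → (ℤ → ℕ) → PMF ℕ} (hP : IsLocallyDetermined b α P) :
    AEMeasurable (fun X => (P ⊤ (profile b X)).toMeasure) (poissonField b α) := by
  classical
  obtain ⟨T, hT, hTm, hT0⟩ :=
    exists_measurable_superset_of_null (ae_iff.mp (ae_eventually_localInf_eq hb hα hP))
  obtain ⟨S, hS, hSm, hSae⟩ : ∃ S : Set (ℤ → ℕ), (∀ X ∈ S, ∀ A : Set ℕ, ∀ᶠ N in atTop,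
      localInf b P A N (profile b X) = (P ⊤ (profile b X)).toMeasure A) ∧ MeasurableSet S ∧
      ∀ᵐ X ∂poissonField b α, X ∈ S :=
    ⟨Tᶜ, fun X hX => by_contra fun h => hX (hT h), hTm.compl, measure_eq_zero_iff_ae_notMem.mp hT0⟩
  refine ⟨fun X => if X ∈ S then (P ⊤ (profile b X)).toMeasure else 0, ?_, ?_⟩
  · refine Measure.measurable_of_measurable_coe _ fun A _ => ?_
    refine measurable_of_tendsto_metrizable (f := fun N X =>
      if X ∈ S then localInf b P A N (profile b X) else 0) (fun N => ?_) ?_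
    · exact Measurable.ite hSm (measurable_localInf.comp (measurable_profile b)) measurable_const
    · refine tendsto_pi_nhds.mpr fun X => tendsto_const_nhds.congr' ?_
      by_cases hX : X ∈ S
      · filter_upwards [hS X hX A] with N hN
        simp [hX, hN]
      · simp [hX]
  · filter_upwards [hSae] with X hX
    simp [hX]

theorem poissonLaw_apply {b : ℕ} (hb : 1 ≤ b) {α : ℝ≥0} (hα : α < 1)
    {P : ℕ∞ → (ℤ → ℕ) → PMF ℕ} (hP : IsLocallyDetermined b α P) (A : Set ℕ) :
    poissonLaw b α P A = ∫⁻ X, (P ⊤ (profile b X)).toMeasure A ∂poissonField b α :=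
  Measure.bind_apply (MeasurableSet.of_discrete) (aemeasurable_toMeasure_profile hb hα hP)

theorem isProbabilityMeasure_poissonLaw {b : ℕ} (hb : 1 ≤ b) {α : ℝ≥0} (hα : α < 1)
    {P : ℕ∞ → (ℤ → ℕ) → PMF ℕ} (hP : IsLocallyDetermined b α P) :
    IsProbabilityMeasure (poissonLaw b α P) :=
  ⟨by rw [poissonLaw_apply hb hα hP]; simp⟩

theorem exactLaw_apply {b m n : ℕ} (P : ℕ∞ → (ℤ → ℕ) → PMF ℕ) (R : ℕ → ℕ → PMF ℕ) [NeZero m]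
    (hn : n ≤ b * m) (A : Set ℕ) :
    (exactLaw b P R m n : Measure ℕ) A = ∑' a, PMF.uniformOfFintype (Fin n → ZMod m) a *
      (P m (profile b (addressCount a))).toMeasure A := by
  change (exactPMF b P R m n).toMeasure A = _
  rw [exactPMF, dif_pos ⟨NeZero.pos m, hn⟩, PMF.toMeasure_bind_apply _ _ _ MeasurableSet.of_discrete]

/-- Without a long overload the actual table competes in the infimum for its cut-off; otherwise the
infimum is at most `1`, which the Chernoff error pays for. -/
theorem tsum_uniform_localInf_le {b m n N K : ℕ} (hb : 1 ≤ b) (P : ℕ∞ → (ℤ → ℕ) → PMF ℕ)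
    (R : ℕ → ℕ → PMF ℕ) [NeZero m] {β : ℝ} (hβ : 0 < β) (hβ1 : β < 1)
    (hn : (n : ℝ) ≤ β * (b * m)) (hK : N < K) (A : Set ℕ) :
    ∑' a, PMF.uniformOfFintype (Fin n → ZMod m) a *
      localInf b P A N (profile b (cutoff K (addressCount a))) ≤
    (exactLaw b P R m n : Measure ℕ) A +
      (2 * N + 2 : ℕ) * (ENNReal.ofReal ((β * Real.exp (1 - β)) ^ b) ^ (K - N) *
        (1 - ENNReal.ofReal ((β * Real.exp (1 - β)) ^ b))⁻¹) := by
  classical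
  have hlt : n < b * m := by
    have h1 : (0 : ℝ) < b * m := by
      have := NeZero.pos m
      positivity
    have h2 : (n : ℝ) < b * m := hn.trans_lt (by nlinarith)
    exact_mod_cast h2
  rw [exactLaw_apply P R hlt.le]
  refine le_trans ?_ (add_le_add le_rfl (tsum_uniform_hasLongOverload_le hβ hβ1 hn))
  rw [← ENNReal.tsum_add]
  refine ENNReal.tsum_le_tsum fun a => ?_
  rw [← mul_add]
  gcongr
  by_cases h : HasLongOverload b m N (K - N) (addressCount a)
  · rw [if_pos h]
    exact (localInf_extendZero_le_one hb _).trans le_add_self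
  · rw [if_neg h, add_zero]
    exact localInf_le (isHashTable_addressCount hlt a) fun i hi =>
      (profile_cutoff_addressCount hlt.le hK h hi).symm

theorem mul_exp_one_sub_lt_one {β : ℝ} (hβ1 : β < 1) : β * Real.exp (1 - β) < 1 := by
  have := Real.add_one_lt_exp (x := β - 1) (by linarith)
  rw [show 1 - β = -(β - 1) by ring, Real.exp_neg, mul_inv_lt_iff₀ (Real.exp_pos _)]
  linarith

theorem poissonLaw_le_liminf_exactLaw {b : ℕ} (hb : 1 ≤ b) {α : ℝ≥0} (hα : α < 1)
    {P : ℕ∞ → (ℤ → ℕ) → PMF ℕ} (hP : IsLocallyDetermined b α P) (R : ℕ → ℕ → PMF ℕ)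
    {m n : ℕ → ℕ} (hm : Tendsto m atTop atTop)
    (hn : Tendsto (fun k => (n k : ℝ) / (b * m k)) atTop (𝓝 (α : ℝ))) (A : Set ℕ) :
    poissonLaw b α P A ≤ liminf (fun k => (exactLaw b P R (m k) (n k) : Measure ℕ) A) atTop := by
  obtain ⟨β, hαβ, hβ1⟩ := exists_between (show (α : ℝ) < 1 by exact_mod_cast hα)
  have hβ : 0 < β := α.2.trans_lt hαβ
  set F := fun k => (exactLaw b P R (m k) (n k) : Measure ℕ) A
  set c := ENNReal.ofReal ((β * Real.exp (1 - β)) ^ b)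
  have hc : c < 1 := by
    rw [ENNReal.ofReal_lt_one]
    exact pow_lt_one₀ (by positivity) (mul_exp_one_sub_lt_one hβ1) (by omega)
  have hload : ∀ᶠ k in atTop, (n k : ℝ) ≤ β * (b * m k) := by
    filter_upwards [hn.eventually_lt_const hαβ, hm.eventually_gt_atTop 0] with k hk hk'
    rw [div_lt_iff₀ (by positivity)] at hk
    exact hk.le
  -- Here `N` and `K` are fixed and the model grows. Then `level` lets `K → ∞`, and the final
  -- computation lets `N → ∞`.
  have cut : ∀ N K, N < K → ∫⁻ X, localInf b P A N (profile b (cutoff K X)) ∂poissonField b α ≤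
      liminf F atTop + (2 * N + 2 : ℕ) * (c ^ (K - N) * (1 - c)⁻¹) := by
    intro N K hK
    rw [← liminf_add_const _ _ _ (by isBoundedDefault) (by isBoundedDefault)]
    refine lintegral_restrict_poissonField_le_liminf hb hm hn K
      (fun x => localInf b P A N (profile b (extendZero x))) _ ?_
    filter_upwards [hload] with k hk h0
    have : NeZero (m k) := ⟨h0⟩
    exact tsum_uniform_localInf_le hb P R hβ hβ1 hk hK A
  have err : ∀ N : ℕ, Tendsto (fun K => liminf F atTop +
      (2 * N + 2 : ℕ) * (c ^ (K - N) * (1 - c)⁻¹)) atTop (𝓝 (liminf F atTop)) := by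
    intro N
    have h1 := (ENNReal.tendsto_pow_atTop_nhds_zero_of_lt_one hc).comp (tendsto_sub_atTop_nat N)
    have h2 := ENNReal.Tendsto.mul_const (b := (1 - c)⁻¹) h1
      (Or.inr (ENNReal.inv_ne_top.mpr (tsub_pos_of_lt hc).ne'))
    have h3 := ENNReal.Tendsto.const_mul (a := ((2 * N + 2 : ℕ) : ENNReal)) h2
      (Or.inr (ENNReal.natCast_ne_top _))
    simpa using h3.const_add (liminf F atTop)
  have level : ∀ N, ∫⁻ X, localInf b P A N (profile b X) ∂poissonField b α ≤ liminf F atTop := by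
    intro N
    calc _ ≤ ∫⁻ X, liminf (fun K => localInf b P A N (profile b (cutoff K X))) atTop
          ∂poissonField b α := by
          refine lintegral_mono_ae ?_
          filter_upwards [ae_loadCondition_poissonField hb hα] with X hX
          refine (Tendsto.liminf_eq (tendsto_const_nhds.congr' ?_)).ge
          filter_upwards [eventually_profile_cutoff hX N] with K hK
          exact localInf_congr fun i hi => (hK i hi).symm
      _ ≤ liminf (fun K => ∫⁻ X, localInf b P A N (profile b (cutoff K X)) ∂poissonField b α)
          atTop := lintegral_liminf_le fun K =>
            (measurable_of_countable fun x => localInf b P A N (profile b (extendZero x))).comp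
              (Finset.measurable_restrict _)
      _ ≤ liminf (fun K => liminf F atTop + (2 * N + 2 : ℕ) * (c ^ (K - N) * (1 - c)⁻¹)) atTop := by
          refine liminf_le_liminf ?_
          filter_upwards [eventually_gt_atTop N] with K hK
          exact cut N K hK
      _ = liminf F atTop := (err N).liminf_eq
  rw [poissonLaw_apply hb hα hP]
  calc _ ≤ ∫⁻ X, liminf (fun N => localInf b P A N (profile b X)) atTop ∂poissonField b α := by
        refine lintegral_mono_ae ?_
        filter_upwards [ae_eventually_localInf_eq hb hα hP] with X hX
        refine (Tendsto.liminf_eq (tendsto_const_nhds.congr' ?_)).ge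
        filter_upwards [hX A] with N hN
        exact hN.symm
    _ ≤ liminf (fun N => ∫⁻ X, localInf b P A N (profile b X) ∂poissonField b α) atTop :=
        lintegral_liminf_le fun N => measurable_localInf.comp (measurable_profile b)
    _ ≤ liminf (fun _ : ℕ => liminf F atTop) atTop :=
        liminf_le_liminf (Eventually.of_forall level)
    _ = _ := liminf_const _

theorem tendsto_exactLaw {b : ℕ} (hb : 1 ≤ b) {α : ℝ≥0} (hα : α < 1)
    {P : ℕ∞ → (ℤ → ℕ) → PMF ℕ} (hP : IsLocallyDetermined b α P) (R : ℕ → ℕ → PMF ℕ)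
    {Pα : ProbabilityMeasure ℕ} (hPα : (Pα : Measure ℕ) = poissonLaw b α P)
    {m n : ℕ → ℕ} (hm : Tendsto m atTop atTop)
    (hn : Tendsto (fun k => (n k : ℝ) / (b * m k)) atTop (𝓝 (α : ℝ))) :
    Tendsto (fun k => exactLaw b P R (m k) (n k)) atTop (𝓝 Pα) := by
  refine tendsto_of_forall_isOpen_le_liminf' fun A _ => ?_
  rw [hPα]
  exact poissonLaw_le_liminf_exactLaw hb hα hP R hm hn A

theorem tendsto_pgf {ι : Type*} {l : Filter ι} {μ : ι → ProbabilityMeasure ℕ}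
    {ν : ProbabilityMeasure ℕ} (h : Tendsto μ l (𝓝 ν)) {q : ℂ} (hq : ‖q‖ ≤ 1) :
    Tendsto (fun k => pgf (μ k) q) l (𝓝 (pgf ν q)) :=
  (ProbabilityMeasure.tendsto_iff_forall_integral_rclike_tendsto ℂ).mp h
    (BoundedContinuousFunction.ofNormedAddCommGroup (fun k : ℕ => q ^ k) continuous_of_discreteTopology
      1 fun k => by rw [norm_pow]; exact pow_le_one₀ (norm_nonneg _) hq)

theorem norm_pgf_le_one (μ : ProbabilityMeasure ℕ) {q : ℂ} (hq : ‖q‖ ≤ 1) :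
    ‖pgf μ q‖ ≤ 1 := by
  have := norm_integral_le_of_norm_le_const (μ := (μ : Measure ℕ)) (f := fun k : ℕ => q ^ k)
    (C := 1) (Eventually.of_forall fun k => by
      rw [norm_pow]; exact pow_le_one₀ (norm_nonneg _) hq)
  simpa [pgf] using this

/-! ### The Poisson transform -/

/-- The transform is an expectation over a Poisson variable of mean `bmα`, whose variance is also
`bmα`. -/
theorem norm_poissonTransform_sub_le {b m : ℕ} {α : ℝ≥0} {f : ℕ → ℂ} {p : ℂ} {ε C : ℝ}
    (hf : ∀ n : ℕ, ‖f n - p‖ ≤ ε + C * (n - b * m * α) ^ 2) :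
    ‖poissonTransform b α m f - p‖ ≤ ε + C * (b * m * α) := by
  set r : ℝ := b * m * α with hr
  have hr0 : 0 ≤ r := by positivity
  set w : ℕ → ℝ := fun n => Real.exp (-r) * r ^ n / n.factorial with hw
  have hw0 : ∀ n, 0 ≤ w n := fun n => by positivity
  have h0 : HasSum w 1 := by simpa using hasSum_poisson_mul_descFactorial r 0
  have hbound : HasSum (fun n => w n * (ε + C * (n - r) ^ 2)) (ε + C * r) := by
    have h := (h0.mul_left ε).add ((hasSum_poisson_mul_sub_sq r).mul_left C)
    rw [mul_one] at h
    refine h.congr_fun fun n => ?_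
    simp only [hw]
    ring
  have hnorm : ∀ n, ‖(w n : ℂ) * (f n - p)‖ ≤ w n * (ε + C * (n - r) ^ 2) := fun n => by
    rw [norm_mul, Complex.norm_real, Real.norm_of_nonneg (hw0 n)]
    exact mul_le_mul_of_nonneg_left (hf n) (hw0 n)
  have hsum : Summable fun n => (w n : ℂ) * (f n - p) := .of_norm_bounded hbound.summable hnorm
  have h1 : HasSum (fun n => (w n : ℂ) * p) p := by
    simpa using (Complex.hasSum_ofReal.mpr h0).mul_right p
  have h2 : poissonTransform b α m f = ∑' n, (w n : ℂ) * f n := by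
    rw [poissonTransform, ← tsum_mul_left]
    refine tsum_congr fun n => ?_
    simp only [hw, hr]
    push_cast
    ring
  have h3 := (hsum.hasSum.add h1).tsum_eq
  simp only [← mul_add, sub_add_cancel] at h3
  rw [h2, h3, add_sub_cancel_right]
  exact tsum_of_norm_bounded hbound hnorm

/-- The filter on pairs `(m, n)` along which `m → ∞` and `n / (b * m) → α`. -/
noncomputable def loadFilter (b : ℕ) (α : ℝ≥0) : Filter (ℕ × ℕ) :=
  comap Prod.fst atTop ⊓ comap (fun x => (x.2 : ℝ) / (b * x.1)) (𝓝 (α : ℝ))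

instance (b : ℕ) (α : ℝ≥0) : (loadFilter b α).IsCountablyGenerated := by
  unfold loadFilter
  infer_instance

theorem tendsto_poissonTransform {b : ℕ} (hb : 1 ≤ b) {α : ℝ≥0} {f : ℕ → ℕ → ℂ} {p : ℂ}
    (hf : ∀ m n, ‖f m n‖ ≤ 1) (hp : ‖p‖ ≤ 1)
    (h : Tendsto (fun x : ℕ × ℕ => f x.1 x.2) (loadFilter b α) (𝓝 p)) :
    Tendsto (fun m => poissonTransform b α m (f m)) atTop (𝓝 p) := by
  have hb0 : (0 : ℝ) < b := by exact_mod_cast hb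
  rw [Metric.tendsto_nhds]
  intro ε hε
  have h1 := Metric.tendsto_nhds.mp h (ε / 2) (by positivity)
  obtain ⟨⟨M, δ⟩, ⟨-, hδ⟩, hMδ⟩ := (((atTop_basis (α := ℕ)).comap Prod.fst).inf
    ((Metric.nhds_basis_ball (x := (α : ℝ))).comap
      fun x : ℕ × ℕ => (x.2 : ℝ) / (b * x.1))).eventually_iff.mp h1
  simp only at hδ
  have hsmall : Tendsto (fun m : ℕ => (2 * α / (δ ^ 2 * b) : ℝ) / m) atTop (𝓝 0) :=
    tendsto_const_div_atTop_nhds_zero_nat _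
  filter_upwards [eventually_ge_atTop M, eventually_gt_atTop 0,
    hsmall.eventually_lt_const (half_pos hε)] with m hM hm hlt
  have hm0 : (0 : ℝ) < m := by exact_mod_cast hm
  rw [dist_eq_norm]
  -- Chebyshev: when `n/(bm)` is at least `δ` from `α`, the quadratic term is at least `2`, which
  -- bounds `‖f m n - p‖`.
  refine (norm_poissonTransform_sub_le (ε := ε / 2) (C := 2 / (δ * (b * m)) ^ 2) fun n => ?_).trans_lt
    ?_
  · by_cases hn : (n : ℝ) / (b * m) ∈ Metric.ball (α : ℝ) δ
    · have h2 := @hMδ (m, n) ⟨hM, hn⟩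
      rw [dist_eq_norm] at h2
      refine h2.le.trans (le_add_of_nonneg_right (by positivity))
    · refine (norm_sub_le _ _).trans ?_
      have h2 : ‖f m n‖ + ‖p‖ ≤ 2 := by linarith [hf m n]
      refine h2.trans (le_add_of_nonneg_of_le (by positivity) ?_)
      rw [Metric.mem_ball, not_lt, Real.dist_eq] at hn
      have h3 : δ * (b * m) ≤ |(n : ℝ) - b * m * α| := by
        rw [← le_div_iff₀ (by positivity), ← abs_of_pos (show 0 < (b : ℝ) * m by positivity),
          ← abs_div, abs_of_pos (show 0 < (b : ℝ) * m by positivity)]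
        refine hn.trans_eq (congrArg abs ?_)
        field_simp
      rw [div_mul_eq_mul_div, le_div_iff₀ (by positivity)]
      gcongr 2 * ?_
      rw [← sq_abs (n - b * m * α : ℝ)]
      gcongr
  · have h2 : 2 / (δ * (b * m)) ^ 2 * (b * m * α) = (2 * α / (δ ^ 2 * b) : ℝ) / m := by
      field_simp
    rw [h2]
    linarith

/-- The filter is countably generated, so sequential limits give the uniformity in `n` needed for
averaging. -/
theorem tendsto_pgf_exactLaw_loadFilter {b : ℕ} (hb : 1 ≤ b) {α : ℝ≥0} (hα : α < 1)
    {P : ℕ∞ → (ℤ → ℕ) → PMF ℕ} (hP : IsLocallyDetermined b α P) (R : ℕ → ℕ → PMF ℕ)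
    {Pα : ProbabilityMeasure ℕ} (hPα : (Pα : Measure ℕ) = poissonLaw b α P) {q : ℂ}
    (hq : ‖q‖ ≤ 1) :
    Tendsto (fun x : ℕ × ℕ => pgf (exactLaw b P R x.1 x.2) q) (loadFilter b α)
      (𝓝 (pgf Pα q)) := by
  refine tendsto_of_seq_tendsto fun u hu => ?_
  rw [loadFilter, tendsto_inf, tendsto_comap_iff, tendsto_comap_iff] at hu
  exact tendsto_pgf (tendsto_exactLaw hb hα hP R hPα hu.1 hu.2) hq

/-! ### The residue of the generating function -/

/-- Abel summation of a convergent sequence. -/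
theorem tendsto_one_sub_mul_tsum_mul_pow {a : ℕ → ℂ} {p : ℂ} (ha : Tendsto a atTop (𝓝 p)) :
    -- This function is the power series of the increments of `a`, whose partial sums are `a n`, so
    -- Abel's limit theorem applies.
    Tendsto (fun x : ℝ => (1 - (x : ℂ)) * ∑' n, a n * (x : ℂ) ^ n) (𝓝[<] 1) (𝓝 p) := by
  set f : ℕ → ℂ := fun n => Nat.casesOn n (a 0) fun k => a (k + 1) - a k with hf
  have hpart : ∀ n, ∑ i ∈ Finset.range (n + 1), f i = a n := by
    intro n
    rw [Finset.sum_range_succ', Finset.sum_range_sub]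
    simp [hf]
  have h1 : Tendsto (fun n => ∑ i ∈ Finset.range n, f i) atTop (𝓝 p) := by
    rw [← tendsto_add_atTop_iff_nat 1]
    simpa only [hpart] using ha
  have h2 := tendsto_map'_iff.mp (Complex.tendsto_tsum_powerSeries_nhdsWithin_lt h1)
  refine h2.congr' ?_
  obtain ⟨C, hC⟩ := (Metric.isBounded_range_of_tendsto a ha).exists_norm_le
  filter_upwards [Ioo_mem_nhdsLT (show (0 : ℝ) < 1 by norm_num)] with x hx
  have hs : Summable fun n => a n * (x : ℂ) ^ n := by
    refine .of_norm_bounded ((summable_geometric_of_lt_one hx.1.le hx.2).mul_left C) fun n => ?_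
    rw [norm_mul, norm_pow, Complex.norm_real, Real.norm_of_nonneg hx.1.le]
    exact mul_le_mul_of_nonneg_right (hC _ ⟨n, rfl⟩) (pow_nonneg hx.1.le n)
  have hs1 : Summable fun n => a (n + 1) * (x : ℂ) ^ (n + 1) :=
    (summable_nat_add_iff (f := fun n => a n * (x : ℂ) ^ n) 1).mpr hs
  have hs2 : Summable fun n => a n * (x : ℂ) ^ (n + 1) := by
    refine (hs.mul_left (x : ℂ)).congr fun n => ?_
    ring
  have h3 : ∀ n, f (n + 1) * (x : ℂ) ^ (n + 1) =
      a (n + 1) * (x : ℂ) ^ (n + 1) - a n * (x : ℂ) ^ (n + 1) := fun n => by simp [hf, sub_mul]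
  have hs3 : Summable fun n => f n * (x : ℂ) ^ n := by
    rw [← summable_nat_add_iff 1]
    simp only [h3]
    exact hs1.sub hs2
  simp only [Function.comp]
  rw [hs3.tsum_eq_zero_add]
  simp only [h3]
  rw [hs1.tsum_sub hs2, sub_mul, one_mul, ← tsum_mul_left]
  rw [hs.tsum_eq_zero_add]
  have h4 : ∑' n, (x : ℂ) * (a n * (x : ℂ) ^ n) = ∑' n, a n * (x : ℂ) ^ (n + 1) :=
    tsum_congr fun n => by ring
  have h5 : f 0 = a 0 := rfl
  rw [h4, h5]
  ring

/-- The factor `e^{-α}` in `w`, raised to the power `bm`, is the normalisation of the Poisson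
weights. -/
theorem trivariateGF_eq_tsum_poissonTransform (b : ℕ) (α : ℝ≥0) (p : ℕ → ℕ → ℂ) (u : ℂ) :
    trivariateGF b p (b * (α : ℝ)) (u * Complex.exp (-(α : ℝ))) =
      ∑' m, poissonTransform b α m (p m) * (u ^ b) ^ m := by
  refine tsum_congr fun m => ?_
  rw [poissonTransform, mul_pow, ← pow_mul, ← Complex.exp_nat_mul]
  have h1 : ∀ n : ℕ, p m n * ((m * (b * ((α : ℝ) : ℂ))) ^ n / n.factorial) =
      ((b * m * (α : ℝ) : ℂ) ^ n / n.factorial) * p m n := fun n => by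
    rw [show (m : ℂ) * (b * ((α : ℝ) : ℂ)) = b * m * (α : ℝ) by ring]
    ring
  rw [tsum_congr h1]
  push_cast
  rw [show (b * m : ℂ) * -((α : ℝ) : ℂ) = -(b * m * (α : ℝ)) by ring]
  ring

theorem HasSimplePoleWithResidue.tendsto_sub_mul {g : ℂ → ℂ} {z₀ ρ : ℂ}
    (h : HasSimplePoleWithResidue g z₀ ρ) :
    Tendsto (fun y => (y - z₀) * g y) (𝓝[≠] z₀) (𝓝 ρ) := by
  obtain ⟨-, k, hk, hg⟩ := h
  have h1 : Tendsto (fun y => ρ + (y - z₀) * k y) (𝓝[≠] z₀) (𝓝 (ρ + (z₀ - z₀) * k z₀)) :=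
    (tendsto_const_nhds.add ((tendsto_id.sub tendsto_const_nhds).mul
      hk.continuousAt.tendsto)).mono_left nhdsWithin_le_nhds
  rw [sub_self, zero_mul, add_zero] at h1
  refine h1.congr' ?_
  filter_upwards [hg, self_mem_nhdsWithin] with y hy hne
  have : y - z₀ ≠ 0 := sub_ne_zero.mpr hne
  rw [hy]
  field_simp

/-- Approach `1` along reals `x < 1`, with `u` the real `b`-th root of `x`: `(x - 1) g x` tends to
`ρ` by the pole and to `-p` by Abel summation. -/
theorem residue_eq_neg_of_eq_tsum {a : ℕ → ℂ} {p ρ : ℂ} {g : ℂ → ℂ} {b : ℕ} (hb : 1 ≤ b)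
    (ha : Tendsto a atTop (𝓝 p))
    (hg : ∀ u : ℂ, ‖u‖ < 1 → g (u ^ b) = ∑' m, a m * (u ^ b) ^ m)
    (hρ : HasSimplePoleWithResidue g 1 ρ) : ρ = -p := by
  have hto : Tendsto (fun x : ℝ => (x : ℂ)) (𝓝[<] 1) (𝓝[≠] 1) := by
    refine tendsto_nhdsWithin_iff.mpr ⟨?_, ?_⟩
    · exact (Complex.continuous_ofReal.tendsto' 1 1 (by simp)).mono_left nhdsWithin_le_nhds
    · filter_upwards [self_mem_nhdsWithin] with x hx
      simpa using (Set.mem_Iio.mp hx).ne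
  refine tendsto_nhds_unique (hρ.tendsto_sub_mul.comp hto) ?_
  refine (tendsto_one_sub_mul_tsum_mul_pow ha).neg.congr' ?_
  filter_upwards [Ioo_mem_nhdsLT (show (0 : ℝ) < 1 by norm_num)] with x hx
  have hroot : (((x ^ (b : ℝ)⁻¹ : ℝ) : ℂ)) ^ b = x := by
    rw [← Complex.ofReal_pow, Real.rpow_inv_natCast_pow hx.1.le (by omega)]
  have hu : ‖((x ^ (b : ℝ)⁻¹ : ℝ) : ℂ)‖ < 1 := by
    rw [Complex.norm_real, Real.norm_of_nonneg (Real.rpow_nonneg hx.1.le _)]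
    exact Real.rpow_lt_one hx.1.le hx.2 (by positivity)
  have h1 := hg _ hu
  rw [hroot] at h1
  simp only [Function.comp, h1]
  ring

theorem mainTheorem1 (b : ℕ) (hb : 1 ≤ b) (α : ℝ≥0) (hα : α < 1)
    (P : ℕ∞ → (ℤ → ℕ) → PMF ℕ) (hP : IsLocallyDetermined b α P)
    (R : ℕ → ℕ → PMF ℕ) :
    ∃ Pα : ProbabilityMeasure ℕ, (Pα : Measure ℕ) = poissonLaw b α P ∧
      (∀ m n : ℕ → ℕ, Tendsto m atTop atTop → Tendsto n atTop atTop →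
        Tendsto (fun k => (n k : ℝ) / (b * m k)) atTop (𝓝 (α : ℝ)) →
        Tendsto (fun k => exactLaw b P R (m k) (n k)) atTop (𝓝 Pα) ∧
        ∀ q : ℂ, ‖q‖ ≤ 1 →
          Tendsto (fun k => pgf (exactLaw b P R (m k) (n k)) q) atTop (𝓝 (pgf Pα q))) ∧
      (∀ q : ℂ, ‖q‖ ≤ 1 →
        Tendsto (fun m : ℕ => poissonTransform b α m fun n => pgf (exactLaw b P R m n) q)
          atTop (𝓝 (pgf Pα q))) ∧
      (∀ (q : ℂ) (r : ℝ) (g : ℂ → ℂ) (ρ : ℂ), ‖q‖ ≤ 1 → 1 < r →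
        (∀ u : ℂ, ‖u‖ < 1 → g (u ^ b) =
          trivariateGF b (fun m n => pgf (exactLaw b P R m n) q)
            (b * (α : ℝ)) (u * Complex.exp (-(α : ℝ)))) →
        DifferentiableOn ℂ g (Metric.ball 0 r \ {1}) →
        HasSimplePoleWithResidue g 1 ρ →
        ρ = -pgf Pα q) := by

  have := isProbabilityMeasure_poissonLaw hb hα hP
  refine ⟨⟨poissonLaw b α P, this⟩, rfl, fun m n hm _ hn => ?_, fun q hq => ?_,
    fun q r g ρ hq _ hg _ hρ => ?_⟩
  · have h := tendsto_exactLaw hb hα hP R (Pα := ⟨poissonLaw b α P, this⟩) rfl hm hn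
    exact ⟨h, fun q hq => tendsto_pgf h hq⟩
  · exact tendsto_poissonTransform hb (fun m n => norm_pgf_le_one _ hq) (norm_pgf_le_one _ hq)
      (tendsto_pgf_exactLaw_loadFilter hb hα hP R rfl hq)
  · refine residue_eq_neg_of_eq_tsum hb (tendsto_poissonTransform hb
      (fun m n => norm_pgf_le_one _ hq) (norm_pgf_le_one _ hq)
      (tendsto_pgf_exactLaw_loadFilter hb hα hP R (Pα := ⟨poissonLaw b α P, this⟩) rfl hq))
      (fun u hu => ?_) hρ
    rw [hg u hu, trivariateGF_eq_tsum_poissonTransform]
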